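/- Let $n\ge 1$, $0<\alpha\le 1$, $\beta>0$, and let $\lambda\in\mathbb C$ satisfy one of the following: (a) $\lambda>0$; (b) there is $\theta$ with $\frac{\pi\alpha}{2}<\theta<\pi\alpha$ and $\theta\le|\arg(-\lambda)|\le\pi$. Let $E_{\alpha,\beta}(z)=\sum_{k\ge 0} z^k/\Gamma(\alpha k+\beta)$ and $\widehat\varphi(\xi)=\int_{\mathbb R^n}\varphi(x)e^{-ix\cdot\xi}\,dx$. For $\varphi\in\mathcal S(\mathbb R^n)$ put $$(-\Delta)^{\frac\gamma2}\varphi(x)=\frac1{(2\pi)^n}\int_{\mathbb R^n}|\xi|^\gamma\widehat\varphi(\xi)e^{ix\cdot\xi}\,d\xi ,$$ $$(-\Delta)^{\frac\eta2}E_{\alpha,\beta}\bigl(-\lambda(-\Delta)^{\frac\sigma2}t^\alpha\bigr)\varphi(x)=\frac1{(2\pi)^n}\int_{\mathbb R^n}|\xi|^\eta E_{\alpha,\beta}(-\lambda|\xi|^\sigma t^\alpha)\widehat\varphi(\xi)e^{ix\cdot\xi}\,d\xi .$$ The homogeneous Sobolev space $\dot W^{s,q}(\mathbb R^n)$ consists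 of the $u\in\mathcal S'(\mathbb R^n)$ with $(-\Delta)^{s/2}u\in L^q(\mathbb R^n)$, where $\mathcal F((-\Delta)^{s/2}u)=|\xi|^s\widehat u$. For $\varepsilon,\nu>0$ and $1\le p,q\le\infty$ (with $n/\infty=0$), write $(p,q)\in\mathcal R_{1,2}(\varepsilon)$ if $$\tfrac n2\le\tfrac np<\min\{n,\varepsilon\}\quad\text{and}\quad \max\{0,\tfrac np-\min\{n,\varepsilon\}\}<\tfrac nq\le\tfrac np-\tfrac n2,$$ and $(p,q)\in\mathcal R_3(\nu,\varepsilon)$ if $$\nu<\tfrac np<\min\{n,\varepsilon\}\quad\text{and}\quad \max\{0,\tfrac np-\min\{n,\varepsilon\}\}<\tfrac nq\le\tfrac np-\nu .$$ **(1)** Suppose that either $\sigma>n$ and $(p,q)=(1,\infty)$, or $\sigma>\frac n2$ and $(p,q)\in\mathcal R_{1,2}(\sigma)$. Then there is a constant $A>0$ such that for all $t>0$ and all $\varphi\in\mathcal S(\mathbb R^n)$ the integrals defining the operators below converge absolutely, $E_{\alpha,\beta}(-\lambda(-\Delta)^{\sigma/2}t^\alpha)\varphi\in L^q(\mathbb R^n)$,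 $E_{\alpha,\alpha}(-\lambda(-\Delta)^{\sigma/2}t^\alpha)\varphi\in\dot W^{\sigma,q}(\mathbb R^n)$, and $$\bigl\|E_{\alpha,\beta}(-\lambda(-\Delta)^{\frac\sigma2}t^\alpha)\varphi\bigr\|_q\le A\,t^{-\frac\alpha\sigma(\frac np-\frac nq)}\|\varphi\|_p,$$ $$\bigl\|(-\Delta)^{\frac\sigma2}E_{\alpha,\alpha}(-\lambda(-\Delta)^{\frac\sigma2}t^\alpha)\varphi\bigr\|_q\le A\,t^{-\alpha-\frac\alpha\sigma(\frac np-\frac nq)}\|\varphi\|_p .$$ **(2)** Suppose that one of the following holds: (i) $0<\gamma<n$, $\sigma>n-\gamma$ and $(p,q)=(1,\infty)$; (ii) $0<\gamma<\frac n2$, $\sigma>\frac n2-\gamma$ and $(p,q)\in\mathcal R_{1,2}(\sigma+\gamma)$; (iii) $\sigma>0$, $\frac n2\le\gamma\le n$ and $(p,q)\in\mathcal R_3(\gamma,\sigma+\gamma)$. Then there is a constant $A>0$ such that for all $t>0$ and all $\varphi\in\mathcal S(\mathbb R^n)$ the integrals defining the operators below converge absolutely, $E_{\alpha,\beta}(-\lambda(-\Delta)^{\sigma/2}t^\alpha)\varphi\in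 L^q(\mathbb R^n)$, $E_{\alpha,\alpha}(-\lambda(-\Delta)^{\sigma/2}t^\alpha)\varphi\in\dot W^{\sigma,q}(\mathbb R^n)$, and $$\bigl\|E_{\alpha,\beta}(-\lambda(-\Delta)^{\frac\sigma2}t^\alpha)\varphi\bigr\|_q\le A\,t^{-\frac\alpha\sigma(\frac np-\frac nq-\gamma)}\bigl\|(-\Delta)^{\frac\gamma2}\varphi\bigr\|_p,$$ $$\bigl\|(-\Delta)^{\frac\sigma2}E_{\alpha,\alpha}(-\lambda(-\Delta)^{\frac\sigma2}t^\alpha)\varphi\bigr\|_q\le A\,t^{-\alpha-\frac\alpha\sigma(\frac np-\frac nq-\gamma)}\bigl\|(-\Delta)^{\frac\gamma2}\varphi\bigr\|_p .$$ -/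

import Mathlib

open MeasureTheory
open scoped ENNReal SchwartzMap FourierTransform

noncomputable section

/-- The two-parameter Mittag-Leffler function
`E_{α,β}(z) = ∑_{k ≥ 0} z ^ k / Γ(α k + β)`. -/
def mittagLeffler (α β : ℝ) (z : ℂ) : ℂ :=
  ∑' k : ℕ, z ^ k / Complex.Gamma ((α : ℂ) * (k : ℂ) + (β : ℂ))

/-- The Fourier transform `φ̂(ξ) = ∫ φ(x) e^{-i x·ξ} dx` (no `2π` in the phase). -/
def angularFourier {n : ℕ} (φ : 𝓢(EuclideanSpace ℝ (Fin n), ℂ))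
    (ξ : EuclideanSpace ℝ (Fin n)) : ℂ :=
  ∫ x : EuclideanSpace ℝ (Fin n),
    φ x * Complex.exp (-(Complex.I * ((inner ℝ x ξ : ℝ) : ℂ)))

/-- The fractional Laplacian of a Schwartz function,
`(-Δ)^{γ/2} φ (x) = (2π)^{-n} ∫ |ξ|^γ φ̂(ξ) e^{i x·ξ} dξ`. -/
def fracLaplacian {n : ℕ} (γ : ℝ) (φ : 𝓢(EuclideanSpace ℝ (Fin n), ℂ))
    (x : EuclideanSpace ℝ (Fin n)) : ℂ :=
  (((2 * Real.pi) ^ n : ℝ) : ℂ)⁻¹ *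
    ∫ ξ : EuclideanSpace ℝ (Fin n),
      ((‖ξ‖ ^ γ : ℝ) : ℂ) * angularFourier φ ξ *
        Complex.exp (Complex.I * ((inner ℝ x ξ : ℝ) : ℂ))

/-- The integrand `|ξ|^η E_{α,β}(-lam |ξ|^σ t^α) φ̂(ξ) e^{i x·ξ}` as a function of `ξ`. -/
def mlIntegrand {n : ℕ} (η α β : ℝ) (lam : ℂ) (σ t : ℝ)
    (φ : 𝓢(EuclideanSpace ℝ (Fin n), ℂ)) (x ξ : EuclideanSpace ℝ (Fin n)) : ℂ :=
  ((‖ξ‖ ^ η : ℝ) : ℂ) * mittagLeffler α β (-lam * ((‖ξ‖ ^ σ * t ^ α : ℝ) : ℂ)) *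
    angularFourier φ ξ * Complex.exp (Complex.I * ((inner ℝ x ξ : ℝ) : ℂ))

/-- The pseudo-differential operator
`(-Δ)^{η/2} E_{α,β}(-lam (-Δ)^{σ/2} t^α) φ (x)
  = (2π)^{-n} ∫ |ξ|^η E_{α,β}(-lam |ξ|^σ t^α) φ̂(ξ) e^{i x·ξ} dξ`. -/
def mlOperator {n : ℕ} (η α β : ℝ) (lam : ℂ) (σ t : ℝ)
    (φ : 𝓢(EuclideanSpace ℝ (Fin n), ℂ)) (x : EuclideanSpace ℝ (Fin n)) : ℂ :=
  (((2 * Real.pi) ^ n : ℝ) : ℂ)⁻¹ *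
    ∫ ξ : EuclideanSpace ℝ (Fin n), mlIntegrand η α β lam σ t φ x ξ

/-- The tempered distribution `T` is given by integration against the function `f`. -/
def Represents {n : ℕ} (T : 𝓢'(EuclideanSpace ℝ (Fin n), ℂ))
    (f : EuclideanSpace ℝ (Fin n) → ℂ) : Prop :=
  ∀ ψ : 𝓢(EuclideanSpace ℝ (Fin n), ℂ),
    Integrable (fun x => ψ x * f x) ∧ T ψ = ∫ x, ψ x * f x

/-- `G = (-Δ)^{s/2} T` for tempered distributions: the Fourier transform of `T` is a function `v`,
and the Fourier transform of `G` is the function `|ξ|^s v`. Mathlib's Fourier transform `𝓕` has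
the phase `e^{-2πi x·ξ}`, for which the symbol of `(-Δ)^{s/2}` is `(2π|ξ|)^s`. -/
def IsFracLaplacian {n : ℕ} (s : ℝ) (T G : 𝓢'(EuclideanSpace ℝ (Fin n), ℂ)) : Prop :=
  ∃ v : EuclideanSpace ℝ (Fin n) → ℂ,
    Represents (𝓕 T) v ∧
    Represents (𝓕 G) (fun ξ => (((2 * Real.pi * ‖ξ‖) ^ s : ℝ) : ℂ) * v ξ)

/-- The function `u` belongs to the homogeneous Sobolev space `Ẇ^{s,p}(ℝⁿ)`: it defines a tempered
distribution `T`, and `(-Δ)^{s/2} T` is a function in `L^p`. -/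
def MemHomSobolev {n : ℕ} (s : ℝ) (p : ℝ≥0∞) (u : EuclideanSpace ℝ (Fin n) → ℂ) : Prop :=
  ∃ (T G : 𝓢'(EuclideanSpace ℝ (Fin n), ℂ)) (g : EuclideanSpace ℝ (Fin n) → ℂ),
    Represents T u ∧ IsFracLaplacian s T G ∧ Represents G g ∧ MemLp g p volume

/-- The number `n / p`, with `n / ∞ = 0`, for `1 ≤ p ≤ ∞`. -/
def dimDiv (n : ℕ) (p : ℝ≥0∞) : ℝ := (n : ℝ) * (p⁻¹).toReal

/-- The region `R_{1,2}(ε)` of exponents `(p, q)`. -/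
def Region12 (n : ℕ) (ε : ℝ) (p q : ℝ≥0∞) : Prop :=
  1 ≤ p ∧ 1 ≤ q ∧
  (n : ℝ) / 2 ≤ dimDiv n p ∧ dimDiv n p < min (n : ℝ) ε ∧
  max 0 (dimDiv n p - min (n : ℝ) ε) < dimDiv n q ∧ dimDiv n q ≤ dimDiv n p - (n : ℝ) / 2

/-- The region `R_3(ν, ε)` of exponents `(p, q)`. -/
def Region3 (n : ℕ) (ν ε : ℝ) (p q : ℝ≥0∞) : Prop :=
  1 ≤ p ∧ 1 ≤ q ∧
  ν < dimDiv n p ∧ dimDiv n p < min (n : ℝ) ε ∧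
  max 0 (dimDiv n p - min (n : ℝ) ε) < dimDiv n q ∧ dimDiv n q ≤ dimDiv n p - ν

/-- The condition on `lam`: either `lam > 0`, or the argument `-lam |ξ|^σ t^α` of the
Mittag-Leffler function lies in a sector `θ ≤ |arg z| ≤ π` with `πα/2 < θ < πα`. -/
def AdmissibleLambda (α : ℝ) (lam : ℂ) : Prop :=
  (∃ l : ℝ, 0 < l ∧ lam = (l : ℂ)) ∨
  ∃ θ : ℝ, Real.pi * α / 2 < θ ∧ θ < Real.pi * α ∧
    θ ≤ |Complex.arg (-lam)| ∧ |Complex.arg (-lam)| ≤ Real.pi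

/-- The tuples `(σ, p, q)` for the `L^p - L^q` and `L^p - Ẇ^{σ,q}` estimates. -/
def LebesgueCase (n : ℕ) (σ : ℝ) (p q : ℝ≥0∞) : Prop :=
  ((n : ℝ) < σ ∧ p = 1 ∧ q = ∞) ∨
  ((n : ℝ) / 2 < σ ∧ Region12 n σ p q)

/-- The tuples `(σ, γ, p, q)` for the `Ẇ^{γ,p} - L^q` and `Ẇ^{γ,p} - Ẇ^{σ,q}` estimates. -/
def SobolevCase (n : ℕ) (σ γ : ℝ) (p q : ℝ≥0∞) : Prop :=
  (0 < γ ∧ γ < n ∧ (n : ℝ) - γ < σ ∧ p = 1 ∧ q = ∞) ∨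
  (0 < γ ∧ γ < (n : ℝ) / 2 ∧ (n : ℝ) / 2 - γ < σ ∧ Region12 n (σ + γ) p q) ∨
  (0 < σ ∧ (n : ℝ) / 2 ≤ γ ∧ γ ≤ n ∧ Region3 n γ (σ + γ) p q)

end

/-! There are two ingredients: decay of order one of `E_{α,β}` along the ray through `-lam`, and a
multiplier estimate that uses only the size of the symbol.

Decay. On the line `Re s = 1` one has `1/Γ(b) = (2πi)⁻¹ ∫ e^s s^{-b} ds`. Summing a geometric series
gives `E_{α,β}(z) = (2πi)⁻¹ ∫ e^s s^{α-β} (s^α - z)⁻¹ ds` for small `z`. The values `s^α` stay in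
the sector `|arg| ≤ πα/2`, and admissibility of `lam` puts `-lam` outside it. Hence the formula
continues analytically along the ray, and `|s^α - z| ≥ c(1 + |z|)` yields `|E_{α,β}(z)| ≤ C/(1 +
|z|)`, provided `β` is large enough for absolute convergence (`mlDecay_of_three_le`). The recurrence
`E_{α,β-1} = (β-1) E_{α,β} + α z E_{α,β}'` and Cauchy's estimate in a cone bring `β` down to any
real value (`mlDecay`). The value `β = 0` matters: `z E_{α,α}(z) = E_{α,0}(z)`, so the symbol `|ξ|^σ
E_{α,α}` obeys the same bound with an extra factor `t^{-α}`.

Estimates. Both symbols are thus dominated by `K |φ̂| / (1 + t^α |ξ|^σ)`, that is, by `K |ξ|^{-γ} /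
(1 + t^α |ξ|^σ)` times the transform of `(-Δ)^{γ/2} φ`. For `(p, q) = (1, ∞)` this kernel is
integrable, and scaling gives the power of `t`. The other regions all force `1 < p < 2 < q < ∞` and
`γ ≤ a ≤ σ + γ` with `a = n/p - n/q`, so the kernel is at most `t^{-(α/σ)(a-γ)} |ξ|^{-a}`. No
smoothness of the symbol is needed, because the path from `L^p` to `L^q` passes through `L²`: the
embedding `Ḣ^{n/2-n/q} ⊂ L^q` (`exists_eLpNorm_fourierInv_le`) and the dual embedding of `L^p`
(`exists_eLpNorm_normWeight_neg_le`) see only absolute values on the Fourier side. -/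

/-! ### Power series and recurrences of the Mittag-Leffler function -/

theorem Real.inv_Gamma_le {b M : ℝ} (hb : 1 ≤ b) (hM : 0 < M) :
    (Real.Gamma b)⁻¹ ≤ Real.exp M * M ^ (1 - b) := by
  have h1 : M ^ (b - 1) * Real.exp (-M) ≤ Real.Gamma b := by
    rw [Real.Gamma_eq_integral (by linarith), ← integral_exp_neg_Ioi M, ← integral_const_mul]
    calc ∫ x in Set.Ioi M, M ^ (b - 1) * Real.exp (-x)
        ≤ ∫ x in Set.Ioi M, Real.exp (-x) * x ^ (b - 1) := by
          refine setIntegral_mono_on ?_ ?_ measurableSet_Ioi fun x hx => ?_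
          · exact (integrableOn_exp_neg_Ioi M).const_mul _
          · exact (Real.GammaIntegral_convergent (by linarith)).mono_set
              (Set.Ioi_subset_Ioi hM.le)
          · rw [mul_comm]
            have : M ≤ x := le_of_lt hx
            gcongr
      _ ≤ ∫ x in Set.Ioi 0, Real.exp (-x) * x ^ (b - 1) := by
          refine setIntegral_mono_set (Real.GammaIntegral_convergent (by linarith)) ?_
            (Set.Ioi_subset_Ioi hM.le).eventuallyLE
          filter_upwards [ae_restrict_mem measurableSet_Ioi] with x hx
          have : (0 : ℝ) < x := hx
          positivity
  have h2 : 0 < M ^ (b - 1) * Real.exp (-M) := by positivity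
  calc (Real.Gamma b)⁻¹ ≤ (M ^ (b - 1) * Real.exp (-M))⁻¹ := by gcongr
    _ = Real.exp M * M ^ (1 - b) := by
      rw [mul_inv, ← Real.exp_neg, neg_neg, ← Real.rpow_neg hM.le, neg_sub, mul_comm]

theorem summable_pow_mul_inv_Gamma {α : ℝ} (β : ℝ) (hα : 0 < α) {R : ℝ} (hR : 0 < R) :
    Summable fun k : ℕ => R ^ k * ‖(Complex.Gamma ((α : ℂ) * (k : ℂ) + (β : ℂ)))⁻¹‖ := by
  -- The cut-off `M` in `Real.inv_Gamma_le` is free; this value makes `M ^ (-α) = 1/(2R)`, so the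
  -- terms are dominated by a geometric series of ratio `1/2`.
  set M : ℝ := (2 * R) ^ (1 / α) with hM
  have hM0 : 0 < M := by positivity
  have hMα : M ^ (-α) = (2 * R)⁻¹ := by
    rw [hM, ← Real.rpow_mul (by positivity)]
    rw [show 1 / α * -α = -1 by field_simp, Real.rpow_neg_one]
  have hs : Summable fun k : ℕ => Real.exp M * M ^ (1 - β) * ((1 / 2 : ℝ)) ^ k :=
    summable_geometric_two.mul_left _
  refine hs.of_norm_bounded_eventually_nat ?_
  have hev : ∀ᶠ k : ℕ in Filter.atTop, 1 - β ≤ α * k :=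
    (tendsto_natCast_atTop_atTop.const_mul_atTop hα).eventually_ge_atTop _
  filter_upwards [hev] with k hk
  have hb : 1 ≤ α * k + β := by linarith
  have hG : Complex.Gamma ((α : ℂ) * (k : ℂ) + (β : ℂ)) = (Real.Gamma (α * k + β) : ℂ) := by
    rw [← Complex.Gamma_ofReal]; push_cast; rfl
  have hpos : 0 < Real.Gamma (α * k + β) := Real.Gamma_pos_of_pos (by linarith)
  rw [hG, ← Complex.ofReal_inv, Complex.norm_real, Real.norm_of_nonneg (by positivity),
    Real.norm_of_nonneg (by positivity)]
  calc R ^ k * (Real.Gamma (α * k + β))⁻¹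
      ≤ R ^ k * (Real.exp M * M ^ (1 - (α * k + β))) := by
        gcongr; exact Real.inv_Gamma_le hb hM0
    _ = Real.exp M * M ^ (1 - β) * ((1 / 2 : ℝ)) ^ k := by
        rw [show 1 - (α * k + β) = (1 - β) + (-α) * k by ring, Real.rpow_add hM0,
          Real.rpow_mul hM0.le, hMα, Real.rpow_natCast]
        have : (1 / 2 : ℝ) ^ k = R ^ k * (2 * R)⁻¹ ^ k := by
          rw [← mul_pow]; congr 1; field_simp
        rw [this]; ring

theorem hasSum_mittagLeffler {α : ℝ} (β : ℝ) (hα : 0 < α) (z : ℂ) :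
    HasSum (fun k : ℕ => z ^ k / Complex.Gamma ((α : ℂ) * (k : ℂ) + (β : ℂ)))
      (mittagLeffler α β z) := by
  refine Summable.hasSum (Summable.of_norm_bounded
    (summable_pow_mul_inv_Gamma β hα (R := ‖z‖ + 1) (by positivity)) fun k => ?_)
  rw [div_eq_mul_inv, norm_mul, norm_pow]
  gcongr
  linarith

/-- The term `k = 0` vanishes because `1/Γ(0) = 0`, which here comes from the conventions `Γ 0 = 0`
and `1 / 0 = 0`; shifting the index then produces one factor `z`. -/
theorem mittagLeffler_zero_right {α : ℝ} (hα : 0 < α) (z : ℂ) :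
    mittagLeffler α 0 z = z * mittagLeffler α α z := by
  have h := hasSum_mittagLeffler 0 hα z
  rw [← h.tsum_eq, h.summable.tsum_eq_zero_add, mittagLeffler, ← tsum_mul_left]
  simp only [pow_zero, Nat.cast_zero, mul_zero, Complex.ofReal_zero, add_zero, Complex.Gamma_zero,
    div_zero, zero_add]
  congr 1
  ext k
  push_cast
  ring_nf

theorem hasSum_deriv_mittagLeffler {α : ℝ} (β : ℝ) (hα : 0 < α) (z : ℂ) :
    Differentiable ℂ (mittagLeffler α β) ∧
    HasSum (fun k : ℕ => (k * z ^ (k - 1)) / Complex.Gamma ((α : ℂ) * (k : ℂ) + (β : ℂ)))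
      (deriv (mittagLeffler α β) z) := by
  have hb : ∀ (R : ℝ) (k : ℕ) (w : ℂ), w ∈ Metric.ball (0 : ℂ) R →
      ‖w ^ k / Complex.Gamma ((α : ℂ) * (k : ℂ) + (β : ℂ))‖ ≤
      R ^ k * ‖(Complex.Gamma ((α : ℂ) * (k : ℂ) + (β : ℂ)))⁻¹‖ := by
    intro R k w hw
    rw [mem_ball_zero_iff] at hw
    rw [div_eq_mul_inv, norm_mul, norm_pow]
    gcongr
  have hd : ∀ (R : ℝ) (k : ℕ), DifferentiableOn ℂ
      (fun w : ℂ => w ^ k / Complex.Gamma ((α : ℂ) * (k : ℂ) + (β : ℂ))) (Metric.ball 0 R) := by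
    intro R k
    fun_prop
  constructor
  · intro w
    have := Complex.differentiableOn_tsum_of_summable_norm
      (summable_pow_mul_inv_Gamma β hα (R := ‖w‖ + 1) (by positivity))
      (hd _) Metric.isOpen_ball (hb _)
    exact this.differentiableAt (Metric.isOpen_ball.mem_nhds (by simp))
  · have := Complex.hasSum_deriv_of_summable_norm
      (summable_pow_mul_inv_Gamma β hα (R := ‖z‖ + 1) (by positivity))
      (hd _) Metric.isOpen_ball (hb _) (z := z) (by simp)
    have he : (fun k : ℕ => (k * z ^ (k - 1)) / Complex.Gamma ((α : ℂ) * (k : ℂ) + (β : ℂ))) =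
        fun k : ℕ => deriv (fun w : ℂ => w ^ k / Complex.Gamma ((α : ℂ) * (k : ℂ) + (β : ℂ))) z := by
      refine funext fun k => ?_
      simp
    rw [he]
    exact this

/-- Termwise this is `1/Γ(s) = s/Γ(s+1)` at `s = αk + β - 1`, the factor `k` being supplied by `z
d/dz`. That form of the functional equation holds at the poles too, so `β` is unrestricted. -/
theorem mittagLeffler_sub_one {α : ℝ} (β : ℝ) (hα : 0 < α) (z : ℂ) :
    mittagLeffler α (β - 1) z =
      (β - 1) * mittagLeffler α β z + α * z * deriv (mittagLeffler α β) z := by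
  have h1 := (hasSum_mittagLeffler β hα z).mul_left ((β : ℂ) - 1)
  have h2 := (hasSum_deriv_mittagLeffler β hα z).2.mul_left ((α : ℂ) * z)
  refine (hasSum_mittagLeffler (β - 1) hα z).unique ?_
  refine (h1.add h2).congr_fun ?_
  intro k
  have hG := Complex.one_div_Gamma_eq_self_mul_one_div_Gamma_add_one
    ((α : ℂ) * (k : ℂ) + ((β - 1 : ℝ) : ℂ))
  have hz : (k : ℂ) * z ^ (k - 1) * z = k * z ^ k := by
    rcases k with _ | k
    · simp
    · simp [pow_succ]; ring
  rw [div_eq_mul_inv, hG]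
  push_cast
  rw [show (α : ℂ) * k + (β - 1) + 1 = α * k + β by ring]
  calc _ = ((β - 1) * z ^ k + α * (k * z ^ k)) / Complex.Gamma (α * k + β) := by ring
    _ = _ := by rw [← hz]; ring

/-! ### Bromwich integrals for `1/Γ` and for the Mittag-Leffler function -/

/-- The vertical line `Re s = 1`, parametrised as `s = 1 + 2πiξ`. -/
noncomputable def bromwichLine (ξ : ℝ) : ℂ := 1 + 2 * Real.pi * ξ * Complex.I

theorem bromwichLine_re (ξ : ℝ) : (bromwichLine ξ).re = 1 := by
  simp [bromwichLine]

theorem bromwichLine_ne_zero (ξ : ℝ) : bromwichLine ξ ≠ 0 := by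
  intro h
  have := bromwichLine_re ξ
  rw [h] at this
  simp at this

theorem one_le_norm_bromwichLine (ξ : ℝ) : 1 ≤ ‖bromwichLine ξ‖ := by
  have := Complex.re_le_norm (bromwichLine ξ)
  rwa [bromwichLine_re] at this

theorem bromwichLine_mem_slitPlane (ξ : ℝ) : bromwichLine ξ ∈ Complex.slitPlane :=
  Or.inl (by rw [bromwichLine_re]; norm_num)

theorem continuous_bromwichLine : Continuous bromwichLine := by
  unfold bromwichLine
  fun_prop

theorem norm_exp_bromwichLine (ξ : ℝ) : ‖Complex.exp (bromwichLine ξ)‖ = Real.exp 1 := by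
  rw [Complex.norm_exp, bromwichLine_re]

theorem norm_bromwichLine_cpow (ξ b : ℝ) :
    ‖bromwichLine ξ ^ (b : ℂ)‖ = ‖bromwichLine ξ‖ ^ b :=
  Complex.norm_cpow_real _ _

theorem continuous_bromwichLine_cpow (b : ℂ) : Continuous fun ξ => bromwichLine ξ ^ b :=
  continuous_bromwichLine.cpow continuous_const bromwichLine_mem_slitPlane

theorem integrable_norm_bromwichLine_rpow {b : ℝ} (hb : b ≤ -2) :
    Integrable fun ξ => ‖bromwichLine ξ‖ ^ b := by
  have h : Integrable fun ξ : ℝ => (1 + (2 * Real.pi * ξ) ^ 2)⁻¹ :=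
    integrable_inv_one_add_sq.comp_mul_left' (by positivity)
  refine h.mono' ?_ (.of_forall fun ξ => ?_)
  · refine (Continuous.rpow_const continuous_bromwichLine.norm fun ξ => ?_).aestronglyMeasurable
    exact Or.inl (norm_ne_zero_iff.2 (bromwichLine_ne_zero ξ))
  · rw [Real.norm_of_nonneg (by positivity)]
    calc ‖bromwichLine ξ‖ ^ b ≤ ‖bromwichLine ξ‖ ^ (-2 : ℝ) :=
          Real.rpow_le_rpow_of_exponent_le (one_le_norm_bromwichLine ξ) hb
      _ = (1 + (2 * Real.pi * ξ) ^ 2)⁻¹ := by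
          rw [Real.rpow_neg (norm_nonneg _)]
          norm_cast
          rw [Complex.sq_norm, Complex.normSq_apply, bromwichLine_re]
          simp [bromwichLine]
          ring

/-- Analytic continuation in `r` of `Complex.integral_cpow_mul_exp_neg_mul_Ioi`. -/
theorem integral_cpow_mul_exp_neg_complex_mul_Ioi {b : ℝ} (hb : 1 ≤ b) {r : ℂ} (hr : 0 < r.re) :
    ∫ t : ℝ in Set.Ioi 0, (t : ℂ) ^ ((b : ℂ) - 1) * Complex.exp (-(r * t)) =
      r ^ (-b : ℂ) * Complex.Gamma b := by
  set U : Set ℂ := {r | 0 < r.re} with hU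
  have hUo : IsOpen U := isOpen_lt continuous_const Complex.continuous_re
  have hUc : IsPreconnected U := (convex_halfSpace_re_gt 0).isPreconnected
  have hnorm : ∀ (c ρ : ℝ) (r : ℂ), ρ ≤ r.re → ∀ t ∈ Set.Ioi (0 : ℝ),
      ‖(t : ℂ) ^ (c : ℂ) * Complex.exp (-(r * t))‖ ≤ t ^ c * Real.exp (-ρ * t) := by
    intro c ρ r hρ t ht
    have ht0 : (0 : ℝ) < t := ht
    rw [norm_mul, Complex.norm_cpow_real, Complex.norm_real, Real.norm_of_nonneg ht0.le,
      Complex.norm_exp]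
    simp only [Complex.neg_re, Complex.re_mul_ofReal, neg_mul]
    gcongr
  have hint : ∀ c : ℝ, 0 ≤ c → ∀ ρ : ℝ, 0 < ρ →
      IntegrableOn (fun t : ℝ => t ^ c * Real.exp (-ρ * t)) (Set.Ioi 0) := by
    intro c hc ρ hρ
    have := integrableOn_rpow_mul_exp_neg_mul_rpow (s := c) (p := 1) (b := ρ) (by linarith)
      one_pos hρ
    simpa using this
  have hmeas : ∀ (c : ℝ) (r : ℂ), AEStronglyMeasurable
      (fun t : ℝ => (t : ℂ) ^ (c : ℂ) * Complex.exp (-(r * t)))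
      (volume.restrict (Set.Ioi 0)) := by
    intro c r
    refine ContinuousOn.aestronglyMeasurable ?_ measurableSet_Ioi
    refine ContinuousOn.mul ?_ (by fun_prop)
    refine ContinuousOn.cpow (by fun_prop) continuousOn_const fun t ht => ?_
    exact Or.inl (by simpa using ht)
  have hL : AnalyticOnNhd ℂ
      (fun r : ℂ => ∫ t : ℝ in Set.Ioi 0, (t : ℂ) ^ ((b - 1 : ℝ) : ℂ) * Complex.exp (-(r * t))) U := by
    refine DifferentiableOn.analyticOnNhd (fun r hr => ?_) hUo
    have hr' : 0 < r.re := hr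
    refine (hasDerivAt_integral_of_dominated_loc_of_deriv_le (𝕜 := ℂ)
      (μ := volume.restrict (Set.Ioi 0))
      (F := fun (r : ℂ) (t : ℝ) => (t : ℂ) ^ ((b - 1 : ℝ) : ℂ) * Complex.exp (-(r * t)))
      (F' := fun (r : ℂ) (t : ℝ) => -((t : ℂ) ^ (b : ℂ) * Complex.exp (-(r * t))))
      (bound := fun t : ℝ => t ^ b * Real.exp (-(r.re / 2) * t))
      (s := {w | r.re / 2 < w.re}) ?_ ?_ ?_ ?_ ?_ ?_ ?_).2.differentiableAt.differentiableWithinAt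
    · refine (isOpen_lt continuous_const Complex.continuous_re).mem_nhds ?_
      change r.re / 2 < r.re
      linarith
    · exact .of_forall fun w => hmeas _ w
    · exact (hint (b - 1) (by linarith) r.re hr').mono' (hmeas _ r)
        ((ae_restrict_mem measurableSet_Ioi).mono fun t ht => hnorm _ _ r le_rfl t ht)
    · exact (hmeas _ r).neg
    · refine (ae_restrict_mem measurableSet_Ioi).mono fun t ht w hw => ?_
      have hw' : r.re / 2 < w.re := hw
      rw [norm_neg]
      exact hnorm _ _ w hw'.le t ht
    · exact hint b (by linarith) _ (by linarith)
    · refine (ae_restrict_mem measurableSet_Ioi).mono fun t ht w hw => ?_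
      have ht0 : (t : ℂ) ≠ 0 := by exact_mod_cast (ne_of_gt (show (0 : ℝ) < t from ht))
      have h1 : HasDerivAt (fun w : ℂ => -(w * t)) (-t) w := by
        have h0 := ((hasDerivAt_id w).mul_const (t : ℂ)).neg
        rw [one_mul] at h0
        exact h0
      have h2 := h1.cexp.const_mul ((t : ℂ) ^ ((b - 1 : ℝ) : ℂ))
      have h3 : (t : ℂ) ^ ((b - 1 : ℝ) : ℂ) * (Complex.exp (-(w * t)) * -t) =
          -((t : ℂ) ^ (b : ℂ) * Complex.exp (-(w * t))) := by
        rw [show (b : ℂ) = ((b - 1 : ℝ) : ℂ) + 1 by push_cast; ring, Complex.cpow_add _ _ ht0,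
          Complex.cpow_one]
        push_cast
        ring_nf
      rw [h3] at h2
      exact h2
  have hR : AnalyticOnNhd ℂ (fun r : ℂ => r ^ (-b : ℂ) * Complex.Gamma b) U := by
    refine DifferentiableOn.analyticOnNhd (fun r hr => ?_) hUo
    refine DifferentiableWithinAt.mul_const ?_ _
    exact DifferentiableWithinAt.cpow_const differentiableWithinAt_id (Or.inl hr)
  -- For real `r > 0` the formula is the known one, and these points accumulate at `1`; this
  -- suffices for the identity theorem on the half plane.
  have hfreq : ∃ᶠ r : ℂ in nhdsWithin 1 {1}ᶜ,
      (∫ t : ℝ in Set.Ioi 0, (t : ℂ) ^ ((b - 1 : ℝ) : ℂ) * Complex.exp (-(r * t))) =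
        r ^ (-b : ℂ) * Complex.Gamma b := by
    have ht : Filter.Tendsto (fun x : ℝ => (x : ℂ)) (nhdsWithin 1 {1}ᶜ) (nhdsWithin 1 {1}ᶜ) := by
      refine tendsto_nhdsWithin_of_tendsto_nhds_of_eventually_within _ ?_ ?_
      · have : Filter.Tendsto (fun x : ℝ => (x : ℂ)) (nhds 1) (nhds ((1 : ℝ) : ℂ)) :=
          Complex.continuous_ofReal.tendsto 1
        rw [Complex.ofReal_one] at this
        exact this.mono_left nhdsWithin_le_nhds
      · filter_upwards [self_mem_nhdsWithin] with x hx
        simpa using hx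
    refine ht.frequently (Filter.Eventually.frequently ?_)
    filter_upwards [nhdsWithin_le_nhds (Ioi_mem_nhds (show (0 : ℝ) < 1 by norm_num))] with x hx
    have hx0 : (0 : ℝ) < x := hx
    have h := Complex.integral_cpow_mul_exp_neg_mul_Ioi (a := (b : ℂ)) (by simp; linarith) hx0
    rw [one_div, Complex.inv_cpow _ _ (by rw [Complex.arg_ofReal_of_nonneg hx0.le]; exact
      Real.pi_pos.ne), ← Complex.cpow_neg] at h
    rw [← h]
    push_cast
    rfl
  have := hL.eqOn_of_preconnected_of_frequently_eq hR hUc (z₀ := 1) (by simp [hU]) hfreq hr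
  simpa using this

/-- Fourier inversion at `t = 1` for `t^{b-1} e^{-t}` on the half line, whose transform is `Γ(b) (1
+ 2πiξ)^{-b}`. The bound `2 ≤ b` makes the transform integrable. -/
theorem inv_Gamma_eq_integral {b : ℝ} (hb : 2 ≤ b) :
    (Complex.Gamma b)⁻¹ =
      ∫ ξ : ℝ, Complex.exp (bromwichLine ξ) * bromwichLine ξ ^ (-b : ℂ) := by
  set f : ℝ → ℂ := (Set.Ioi (0 : ℝ)).indicator fun t => (t : ℂ) ^ ((b : ℂ) - 1) * Complex.exp (-t)
    with hf
  have hfi : Integrable f := by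
    rw [hf, integrable_indicator_iff measurableSet_Ioi]
    have := Complex.GammaIntegral_convergent (s := (b : ℂ)) (by simp; linarith)
    refine this.congr_fun (fun x _ => ?_) measurableSet_Ioi
    simp only [Complex.ofReal_exp, Complex.ofReal_neg]
    ring
  have hFf : ∀ ξ, 𝓕 f ξ = Complex.Gamma b * bromwichLine ξ ^ (-b : ℂ) := by
    intro ξ
    have h := integral_cpow_mul_exp_neg_complex_mul_Ioi (b := b) (r := bromwichLine ξ)
      (by linarith) (by rw [bromwichLine_re]; norm_num)
    rw [mul_comm (bromwichLine ξ ^ _)] at h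
    rw [← h, Real.fourier_real_eq_integral_exp_smul, ← integral_indicator measurableSet_Ioi]
    refine integral_congr_ae (.of_forall fun t => ?_)
    by_cases ht : t ∈ Set.Ioi (0 : ℝ)
    · simp only [hf, Set.indicator_of_mem ht, smul_eq_mul]
      rw [mul_left_comm, ← Complex.exp_add]
      congr 2
      simp only [bromwichLine]
      push_cast
      ring
    · simp [hf, Set.indicator_of_notMem ht]
  have hFi : Integrable (𝓕 f) := by
    rw [funext hFf]
    refine Integrable.const_mul ?_ _
    refine (integrable_norm_bromwichLine_rpow (b := -b) (by linarith)).mono'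
      (continuous_bromwichLine_cpow _).aestronglyMeasurable (.of_forall fun ξ => ?_)
    rw [← Complex.ofReal_neg, norm_bromwichLine_cpow]
  have hc : ContinuousAt f 1 := by
    have h1 : ContinuousAt (fun t : ℝ => (t : ℂ) ^ ((b : ℂ) - 1) * Complex.exp (-t)) 1 := by
      refine ContinuousAt.mul ?_ (by fun_prop)
      exact ContinuousAt.cpow (by fun_prop) continuousAt_const (by simp)
    refine h1.congr ?_
    filter_upwards [Ioi_mem_nhds (show (0 : ℝ) < 1 by norm_num)] with t ht
    rw [hf, Set.indicator_of_mem ht]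
  have hinv := hfi.fourierInv_fourier_eq hFi hc
  have hG : Complex.Gamma b ≠ 0 := by
    rw [Complex.Gamma_ofReal]
    exact_mod_cast (Real.Gamma_pos_of_pos (by linarith)).ne'
  rw [Real.fourierInv_eq'] at hinv
  simp only [hFf] at hinv
  have h1 : f 1 = Complex.exp (-1) := by simp [hf]
  rw [h1] at hinv
  refine inv_eq_of_mul_eq_one_right ?_
  rw [← integral_const_mul]
  calc _ = Complex.exp 1 * Complex.exp (-1) := by
        rw [← hinv, ← integral_const_mul]
        refine integral_congr_ae (.of_forall fun ξ => ?_)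
        simp only [smul_eq_mul, bromwichLine]
        rw [Complex.exp_add]
        simp
        ring_nf
    _ = 1 := by rw [← Complex.exp_add]; simp

/-- The inverse Laplace transform, at time `1`, of `s ^ (α - β) / (s ^ α - z)`. -/
noncomputable def bromwichIntegral (α β : ℝ) (z : ℂ) : ℂ :=
  ∫ ξ : ℝ, Complex.exp (bromwichLine ξ) * bromwichLine ξ ^ ((α - β : ℝ) : ℂ) *
    (bromwichLine ξ ^ (α : ℂ) - z)⁻¹

/-- The integrals for `1/Γ(αk + β)` are summed under the integral sign. Since `|s| ≥ 1` on the line,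
`|z| < 1` makes the geometric series in `z s^{-α}` converge uniformly there. -/
theorem mittagLeffler_eq_bromwichIntegral {α β : ℝ} (hα : 0 < α) (hβ : 2 ≤ β) {z : ℂ}
    (hz : ‖z‖ < 1) : mittagLeffler α β z = bromwichIntegral α β z := by
  set F : ℕ → ℝ → ℂ := fun k ξ =>
    z ^ k * (Complex.exp (bromwichLine ξ) * bromwichLine ξ ^ (-(α * k + β : ℝ) : ℂ)) with hF
  have hnorm : ∀ k ξ, ‖F k ξ‖ ≤ ‖z‖ ^ k * (Real.exp 1 * ‖bromwichLine ξ‖ ^ (-2 : ℝ)) := by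
    intro k ξ
    simp only [hF]
    rw [norm_mul, norm_pow, norm_mul, norm_exp_bromwichLine, ← Complex.ofReal_neg,
      norm_bromwichLine_cpow]
    gcongr
    · exact one_le_norm_bromwichLine ξ
    · have : 0 ≤ α * k := by positivity
      linarith
  have hI2 : Integrable fun ξ => Real.exp 1 * ‖bromwichLine ξ‖ ^ (-2 : ℝ) :=
    (integrable_norm_bromwichLine_rpow le_rfl).const_mul _
  have hFi : ∀ k, Integrable (F k) := by
    intro k
    refine (hI2.const_mul (‖z‖ ^ k)).mono' ?_ (.of_forall (hnorm k))
    refine Continuous.aestronglyMeasurable ?_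
    exact continuous_const.mul ((Complex.continuous_exp.comp continuous_bromwichLine).mul
      (continuous_bromwichLine_cpow _))
  have hsum : Summable fun k => ∫ ξ, ‖F k ξ‖ := by
    refine Summable.of_nonneg_of_le (fun k => integral_nonneg fun ξ => norm_nonneg _) (fun k => ?_)
      ((summable_geometric_of_lt_one (norm_nonneg z) hz).mul_right
        (∫ ξ, Real.exp 1 * ‖bromwichLine ξ‖ ^ (-2 : ℝ)))
    rw [← integral_const_mul]
    exact integral_mono (hFi k).norm (hI2.const_mul _) (hnorm k)
  have h := hasSum_integral_of_summable_integral_norm hFi hsum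
  have hterm : ∀ k : ℕ, ∫ ξ, F k ξ = z ^ k / Complex.Gamma ((α : ℂ) * (k : ℂ) + (β : ℂ)) := by
    intro k
    have : 0 ≤ α * k := by positivity
    simp only [hF]
    rw [integral_const_mul, ← inv_Gamma_eq_integral (by linarith), div_eq_mul_inv]
    push_cast
    rfl
  simp only [hterm] at h
  refine (hasSum_mittagLeffler β hα z).unique ?_
  suffices hE : (fun ξ => ∑' k, F k ξ) = fun ξ => Complex.exp (bromwichLine ξ) *
      bromwichLine ξ ^ ((α - β : ℝ) : ℂ) * (bromwichLine ξ ^ (α : ℂ) - z)⁻¹ by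
    rwa [hE] at h
  refine funext fun ξ => ?_
  have hs := bromwichLine_ne_zero ξ
  have hsα : bromwichLine ξ ^ (α : ℂ) ≠ 0 := by simp [Complex.cpow_eq_zero_iff, hs]
  have hlt : ‖z * (bromwichLine ξ ^ (α : ℂ))⁻¹‖ < 1 := by
    rw [norm_mul, norm_inv, norm_bromwichLine_cpow]
    have h1 : 1 ≤ ‖bromwichLine ξ‖ ^ α := Real.one_le_rpow (one_le_norm_bromwichLine ξ) hα.le
    calc ‖z‖ * (‖bromwichLine ξ‖ ^ α)⁻¹ ≤ ‖z‖ * 1 := by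
          gcongr; exact inv_le_one_of_one_le₀ h1
      _ < 1 := by simpa
  have hg := (hasSum_geometric_of_norm_lt_one hlt).mul_left
    (Complex.exp (bromwichLine ξ) * bromwichLine ξ ^ (-β : ℂ))
  have hterms : ∀ k : ℕ, F k ξ = Complex.exp (bromwichLine ξ) * bromwichLine ξ ^ (-β : ℂ) *
      (z * (bromwichLine ξ ^ (α : ℂ))⁻¹) ^ k := by
    intro k
    simp only [hF]
    have : bromwichLine ξ ^ (-(α * k + β : ℝ) : ℂ) =
        bromwichLine ξ ^ (-β : ℂ) * ((bromwichLine ξ ^ (α : ℂ))⁻¹) ^ k := by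
      rw [← Complex.cpow_neg, ← Complex.cpow_nat_mul, ← Complex.cpow_add _ _ hs]
      congr 1
      push_cast
      ring
    rw [this, mul_pow]
    ring
  simp only [hterms]
  rw [hg.tsum_eq]
  have hne : bromwichLine ξ ^ (α : ℂ) - z ≠ 0 := by
    intro h0
    rw [sub_eq_zero] at h0
    rw [← h0, mul_inv_cancel₀ hsα] at hlt
    simp at hlt
  rw [show ((α - β : ℝ) : ℂ) = (α : ℂ) + (-β : ℂ) by push_cast; ring, Complex.cpow_add _ _ hs]
  have : 1 - z * (bromwichLine ξ ^ (α : ℂ))⁻¹ =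
      (bromwichLine ξ ^ (α : ℂ) - z) * (bromwichLine ξ ^ (α : ℂ))⁻¹ := by
    field_simp
  rw [this, mul_inv, inv_inv]
  ring

theorem differentiableOn_bromwichIntegral {α β c : ℝ} (hβ : α + 2 ≤ β) (hc : 0 < c) {U : Set ℂ}
    (hU : IsOpen U) (hcU : ∀ z ∈ U, ∀ ξ, c ≤ ‖bromwichLine ξ ^ (α : ℂ) - z‖) :
    DifferentiableOn ℂ (bromwichIntegral α β) U := by
  intro z hz
  have hne : ∀ w ∈ U, ∀ ξ, bromwichLine ξ ^ (α : ℂ) - w ≠ 0 := fun w hw ξ =>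
    norm_pos_iff.1 (hc.trans_le (hcU w hw ξ))
  have hcont : ∀ w ∈ U, Continuous fun ξ => (bromwichLine ξ ^ (α : ℂ) - w)⁻¹ := fun w hw =>
    ((continuous_bromwichLine_cpow _).sub continuous_const).inv₀ (hne w hw)
  have hcont2 : Continuous fun ξ =>
      Complex.exp (bromwichLine ξ) * bromwichLine ξ ^ ((α - β : ℝ) : ℂ) :=
    (Complex.continuous_exp.comp continuous_bromwichLine).mul (continuous_bromwichLine_cpow _)
  have hI2 : Integrable fun ξ => Real.exp 1 * ‖bromwichLine ξ‖ ^ (α - β) :=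
    (integrable_norm_bromwichLine_rpow (by linarith)).const_mul _
  have hn : ∀ ξ, ‖Complex.exp (bromwichLine ξ) * bromwichLine ξ ^ ((α - β : ℝ) : ℂ)‖ =
      Real.exp 1 * ‖bromwichLine ξ‖ ^ (α - β) := fun ξ => by
    rw [norm_mul, norm_exp_bromwichLine, norm_bromwichLine_cpow]
  refine (hasDerivAt_integral_of_dominated_loc_of_deriv_le (𝕜 := ℂ) (μ := volume)
    (F := fun z ξ => Complex.exp (bromwichLine ξ) * bromwichLine ξ ^ ((α - β : ℝ) : ℂ) *
      (bromwichLine ξ ^ (α : ℂ) - z)⁻¹)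
    (F' := fun z ξ => Complex.exp (bromwichLine ξ) * bromwichLine ξ ^ ((α - β : ℝ) : ℂ) *
      ((bromwichLine ξ ^ (α : ℂ) - z)⁻¹ ^ 2))
    (bound := fun ξ => Real.exp 1 * ‖bromwichLine ξ‖ ^ (α - β) * c⁻¹ ^ 2)
    (s := U) (hU.mem_nhds hz) ?_ ?_ ?_ ?_ ?_ ?_).2.differentiableAt.differentiableWithinAt
  · filter_upwards [hU.mem_nhds hz] with w hw
    exact (hcont2.mul (hcont w hw)).aestronglyMeasurable
  · refine (hI2.mul_const c⁻¹).mono' (hcont2.mul (hcont z hz)).aestronglyMeasurable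
      (.of_forall fun ξ => ?_)
    rw [norm_mul, hn, norm_inv]
    gcongr
    exact hcU z hz ξ
  · exact (hcont2.mul ((hcont z hz).pow 2)).aestronglyMeasurable
  · refine .of_forall fun ξ w hw => ?_
    rw [norm_mul, hn, norm_pow, norm_inv]
    gcongr
    exact hcU w hw ξ
  · exact hI2.mul_const _
  · refine .of_forall fun ξ w hw => ?_
    have h1 : HasDerivAt (fun w : ℂ => bromwichLine ξ ^ (α : ℂ) - w) (-1) w := by
      simpa using (hasDerivAt_id w).const_sub (bromwichLine ξ ^ (α : ℂ))
    have := (h1.inv (hne w hw ξ)).const_mul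
      (Complex.exp (bromwichLine ξ) * bromwichLine ξ ^ ((α - β : ℝ) : ℂ))
    rw [neg_neg, one_div, ← inv_pow] at this
    exact this

/-! ### Decay of order one outside the sector `|arg z| ≤ πα/2` -/

/-- The complement of the closed sector `|arg z| ≤ πα/2`. -/
def OutsideSector (α : ℝ) (z : ℂ) : Prop := z.re < ‖z‖ * Real.cos (Real.pi * α / 2)

theorem isOpen_outsideSector (α : ℝ) : IsOpen {z | OutsideSector α z} := by
  unfold OutsideSector
  exact isOpen_lt (by fun_prop) (by fun_prop)

/-- On the line `|arg s| ≤ π/2`, hence `|arg s^α| ≤ πα/2`. -/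
theorem not_outsideSector_bromwichLine_cpow {α : ℝ} (hα0 : 0 < α) (hα1 : α ≤ 1) (ξ : ℝ) :
    ‖bromwichLine ξ ^ (α : ℂ)‖ * Real.cos (Real.pi * α / 2) ≤ (bromwichLine ξ ^ (α : ℂ)).re := by
  set s := bromwichLine ξ
  have harg : |s.arg| ≤ Real.pi / 2 :=
    Complex.abs_arg_le_pi_div_two_iff.2 (by rw [bromwichLine_re]; norm_num)
  have hre : (s ^ (α : ℂ)).re = ‖s‖ ^ α * Real.cos (α * s.arg) := by
    rw [Complex.cpow_ofReal_re, mul_comm α]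
  rw [hre, norm_bromwichLine_cpow]
  gcongr
  rw [← Real.cos_abs (α * s.arg), abs_mul, abs_of_pos hα0]
  refine Real.cos_le_cos_of_nonneg_of_le_pi (by positivity) ?_ ?_
  · nlinarith [Real.pi_pos]
  · nlinarith

/-- In a narrow cone around a direction outside the sector `|arg z| ≤ πα/2`,
`|s ^ α - z| ≥ c (1 + |z|)` on the line `Re s = 1`. -/
theorem exists_le_norm_bromwichLine_cpow_sub {α : ℝ} (hα0 : 0 < α) (hα1 : α ≤ 1) {ω : ℂ}
    (hω : OutsideSector α ω) :
    ∃ δ > 0, ∃ c > 0, ∀ w ∈ Metric.ball ω δ, ∀ r : ℝ, 0 ≤ r → ∀ ξ,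
      c * (1 + r) ≤ ‖bromwichLine ξ ^ (α : ℂ) - r * w‖ := by
  obtain ⟨d, hd0, hd⟩ := Metric.isOpen_iff.1 (isOpen_outsideSector α) ω hω
  set B : ℝ := ‖ω‖ + d with hB
  have hB0 : 0 < B := by positivity
  -- The first entry of the minimum serves `r ≤ 1/(2B)`, where `|s^α| ≥ 1` and `|rw| ≤ 1/2`; the
  -- second serves larger `r`, where `1 + r ≤ (2B + 1) r`.
  refine ⟨d / 2, by positivity, min ((1 / 2) / (1 + (2 * B)⁻¹)) ((d / 2) / (2 * B + 1)),
    by positivity, ?_⟩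
  intro w hw r hr ξ
  rw [Metric.mem_ball, dist_eq_norm] at hw
  have hwB : ‖w‖ ≤ B := by
    have : ‖w‖ ≤ ‖ω‖ + ‖w - ω‖ := by simpa using norm_add_le ω (w - ω)
    linarith
  have h1 : 1 ≤ ‖bromwichLine ξ ^ (α : ℂ)‖ := by
    rw [norm_bromwichLine_cpow]
    exact Real.one_le_rpow (one_le_norm_bromwichLine ξ) hα0.le
  by_cases hrB : r ≤ (2 * B)⁻¹
  · have hrw : ‖(r : ℂ) * w‖ ≤ 1 / 2 := by
      rw [norm_mul, Complex.norm_real, Real.norm_of_nonneg hr]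
      calc r * ‖w‖ ≤ (2 * B)⁻¹ * B := by gcongr
        _ = 1 / 2 := by field_simp
    have h2 := norm_sub_norm_le (bromwichLine ξ ^ (α : ℂ)) (r * w)
    calc _ ≤ (1 / 2) / (1 + (2 * B)⁻¹) * (1 + (2 * B)⁻¹) := by
          gcongr
          exact min_le_left _ _
      _ = 1 / 2 := by field_simp
      _ ≤ _ := by linarith
  · push Not at hrB
    have hr0 : 0 < r := lt_of_le_of_lt (by positivity) hrB
    have hrB' : 1 ≤ 2 * B * r := by
      rw [inv_lt_iff_one_lt_mul₀ (by positivity)] at hrB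
      linarith
    -- Otherwise `s^α / r` would lie within `d` of `ω`, hence outside the sector, although the
    -- sector is invariant under positive dilations and contains `s^α`.
    have h2 : r * (d / 2) ≤ ‖bromwichLine ξ ^ (α : ℂ) - r * w‖ := by
      by_contra! hlt
      have hmem : (r : ℂ)⁻¹ * bromwichLine ξ ^ (α : ℂ) ∈ Metric.ball ω d := by
        rw [Metric.mem_ball, dist_eq_norm]
        have hrc : (r : ℂ) ≠ 0 := by exact_mod_cast hr0.ne'
        have : (r : ℂ)⁻¹ * bromwichLine ξ ^ (α : ℂ) - ω =
            (r : ℂ)⁻¹ * (bromwichLine ξ ^ (α : ℂ) - r * w) + (w - ω) := by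
          field_simp
          ring
        rw [this]
        refine (norm_add_le _ _).trans_lt ?_
        rw [norm_mul, norm_inv, Complex.norm_real, Real.norm_of_nonneg hr]
        have : r⁻¹ * ‖bromwichLine ξ ^ (α : ℂ) - r * w‖ < d / 2 := by
          rw [inv_mul_lt_iff₀ hr0]
          exact hlt
        linarith
      have hout : OutsideSector α _ := hd hmem
      have hnot := not_outsideSector_bromwichLine_cpow hα0 hα1 ξ
      unfold OutsideSector at hout
      rw [norm_mul, norm_inv, Complex.norm_real, Real.norm_of_nonneg hr, ← Complex.ofReal_inv,
        Complex.re_ofReal_mul, mul_assoc] at hout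
      exact absurd (lt_of_mul_lt_mul_left hout (by positivity)) (not_lt.2 hnot)
    calc _ ≤ (d / 2) / (2 * B + 1) * (2 * B * r + r) := by
          gcongr
          exact min_le_right _ _
      _ = r * (d / 2) := by field_simp
      _ ≤ _ := h2

/-- Both sides are analytic near the closed ray from `0` through `w` and agree near `0`; a ray is
connected, so the identity theorem applies. -/
theorem mittagLeffler_eq_bromwichIntegral_of_outsideSector {α β : ℝ} (hα0 : 0 < α) (hα1 : α ≤ 1)
    (hβ : 3 ≤ β) {w : ℂ} (hw : OutsideSector α w) {r : ℝ} (hr : 0 ≤ r) :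
    mittagLeffler α β (r * w) = bromwichIntegral α β (r * w) := by
  have hsmall : ∀ z : ℂ, ‖z‖ < 1 → mittagLeffler α β z = bromwichIntegral α β z := fun z hz =>
    mittagLeffler_eq_bromwichIntegral hα0 (by linarith) hz
  have hnear : mittagLeffler α β =ᶠ[nhds 0] bromwichIntegral α β := by
    filter_upwards [Metric.ball_mem_nhds (0 : ℂ) one_pos] with z hz
    exact hsmall z (by simpa using hz)
  have hE : AnalyticOnNhd ℂ (mittagLeffler α β) Set.univ :=
    ((hasSum_deriv_mittagLeffler β hα0 0).1.differentiableOn).analyticOnNhd isOpen_univ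
  obtain ⟨δ, hδ, c, hc, hcw⟩ := exists_le_norm_bromwichLine_cpow_sub hα0 hα1 hw
  set S : Set ℂ := (fun r : ℝ => (r : ℂ) * w) '' Set.Ici 0 with hS
  have hSpre : IsPreconnected S :=
    isPreconnected_Ici.image _ (by fun_prop)
  have hB : AnalyticOnNhd ℂ (bromwichIntegral α β) S := by
    rintro _ ⟨r, hr : 0 ≤ r, rfl⟩
    -- The cone around the ray is not a neighbourhood of the vertex, so analyticity at `0` is
    -- inherited from the power series.
    rcases hr.eq_or_lt with rfl | hr0
    · simp only [Complex.ofReal_zero, zero_mul]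
      exact (hE 0 trivial).congr hnear
    · have hU : IsOpen {z : ℂ | (r : ℂ)⁻¹ * z ∈ Metric.ball w δ} :=
        Metric.isOpen_ball.preimage (by fun_prop)
      have hrc : (r : ℂ) ≠ 0 := by exact_mod_cast hr0.ne'
      refine (differentiableOn_bromwichIntegral (c := c) (by linarith) hc hU ?_).analyticAt
        (hU.mem_nhds ?_)
      · intro z hz ξ
        have := hcw _ hz r hr ξ
        rw [mul_inv_cancel_left₀ hrc] at this
        refine le_trans ?_ this
        nlinarith
      · simp only [Set.mem_ofPred_eq]
        rw [inv_mul_cancel_left₀ hrc]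
        exact Metric.mem_ball_self hδ
  exact (hE.mono (Set.subset_univ S)).eqOn_of_preconnected_of_eventuallyEq hB hSpre
    (z₀ := 0) ⟨0, by simp, by simp⟩ hnear ⟨r, hr, rfl⟩

/-- Decay of order one of `E_{α,β}` in a narrow cone around the ray through `ω`. -/
def MLDecay (α β : ℝ) (ω : ℂ) : Prop :=
  ∃ δ > 0, ∃ C > 0, ∀ w ∈ Metric.ball ω δ, ∀ r : ℝ, 0 ≤ r →
    ‖mittagLeffler α β (r * w)‖ ≤ C / (1 + r)

theorem mlDecay_of_three_le {α β : ℝ} (hα0 : 0 < α) (hα1 : α ≤ 1) (hβ : 3 ≤ β) {ω : ℂ}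
    (hω : OutsideSector α ω) : MLDecay α β ω := by
  obtain ⟨δ, hδ, c, hc, hcw⟩ := exists_le_norm_bromwichLine_cpow_sub hα0 hα1 hω
  obtain ⟨d, hd0, hd⟩ := Metric.isOpen_iff.1 (isOpen_outsideSector α) ω hω
  set J : ℝ := ∫ ξ, Real.exp 1 * ‖bromwichLine ξ‖ ^ (α - β) with hJ
  have hJ0 : 0 ≤ J := integral_nonneg fun ξ => by positivity
  have hI2 : Integrable fun ξ => Real.exp 1 * ‖bromwichLine ξ‖ ^ (α - β) :=
    (integrable_norm_bromwichLine_rpow (by linarith)).const_mul _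
  refine ⟨min δ d, by positivity, (J + 1) / c, by positivity, fun w hw r hr => ?_⟩
  rw [mittagLeffler_eq_bromwichIntegral_of_outsideSector hα0 hα1 hβ
    (hd (Metric.ball_subset_ball (min_le_right _ _) hw)) hr, bromwichIntegral]
  have hw' := Metric.ball_subset_ball (min_le_left _ _) hw
  calc _ ≤ ∫ ξ, Real.exp 1 * ‖bromwichLine ξ‖ ^ (α - β) * (c * (1 + r))⁻¹ := by
        refine norm_integral_le_of_norm_le (hI2.mul_const _) (.of_forall fun ξ => ?_)
        rw [norm_mul, norm_mul, norm_exp_bromwichLine, norm_bromwichLine_cpow, norm_inv]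
        gcongr
        exact hcw w hw' r hr ξ
    _ = J / c / (1 + r) := by rw [integral_mul_const]; field_simp; rfl
    _ ≤ (J + 1) / c / (1 + r) := by gcongr; linarith

/-- Cauchy's estimate is applied to `w ↦ E_{α,β}(rw)`, whose derivative already carries the factor
`r`; so `z E'(z)` decays like `E` itself. This is why decay is stated on a cone: each step halves
its radius `δ`, and discs of radius `δ/4` about points of the smaller ball stay in the larger one.
-/
theorem MLDecay.sub_one {α β : ℝ} (hα0 : 0 < α) {ω : ℂ} (h : MLDecay α β ω) :
    MLDecay α (β - 1) ω := by
  obtain ⟨δ, hδ, C, hC, hb⟩ := h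
  have hd := (hasSum_deriv_mittagLeffler β hα0 0).1
  refine ⟨δ / 2, by positivity,
    |β - 1| * C + α * (‖ω‖ + δ) * (C / (δ / 4)), by positivity, fun w hw r hr => ?_⟩
  rw [Metric.mem_ball] at hw
  have hwB : ‖w‖ ≤ ‖ω‖ + δ := by
    have : ‖w‖ ≤ ‖ω‖ + ‖w - ω‖ := by simpa using norm_add_le ω (w - ω)
    rw [dist_eq_norm] at hw
    linarith
  have hderiv : deriv (fun w : ℂ => mittagLeffler α β (r * w)) w =
      r * deriv (mittagLeffler α β) (r * w) := by
    have h1 : HasDerivAt (fun w : ℂ => (r : ℂ) * w) r w := by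
      simpa using (hasDerivAt_id w).const_mul (r : ℂ)
    have := (hd.differentiableAt (x := r * w)).hasDerivAt.comp w h1
    rw [mul_comm]
    exact this.deriv
  have hcauchy : ‖(r : ℂ) * deriv (mittagLeffler α β) (r * w)‖ ≤ (C / (1 + r)) / (δ / 4) := by
    rw [← hderiv]
    refine Complex.norm_deriv_le_of_forall_mem_sphere_norm_le (by positivity) ?_ ?_
    · exact (hd.comp (differentiable_id.const_mul (r : ℂ))).diffContOnCl
    · intro v hv
      refine hb v ?_ r hr
      rw [Metric.mem_ball]
      rw [Metric.mem_sphere] at hv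
      linarith [dist_triangle v w ω]
  rw [mittagLeffler_sub_one β hα0]
  calc _ ≤ ‖((β : ℂ) - 1) * mittagLeffler α β (r * w)‖ +
        ‖(α : ℂ) * w * (r * deriv (mittagLeffler α β) (r * w))‖ := by
        refine (norm_add_le _ _).trans_eq ?_
        congr 2
        ring
    _ ≤ |β - 1| * (C / (1 + r)) + α * (‖ω‖ + δ) * ((C / (1 + r)) / (δ / 4)) := by
        rw [norm_mul, norm_mul, norm_mul (α : ℂ), Complex.norm_real, Real.norm_of_nonneg hα0.le,
          ← Complex.ofReal_one, ← Complex.ofReal_sub, Complex.norm_real, Real.norm_eq_abs]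
        gcongr
        exact hb w (Metric.mem_ball.2 (by linarith)) r hr
    _ = _ := by field_simp

/-- The recurrence descends `N` times from `β + N ≥ 3`, where the contour integral converges
absolutely. -/
theorem mlDecay {α : ℝ} (β : ℝ) (hα0 : 0 < α) (hα1 : α ≤ 1) {ω : ℂ}
    (hω : OutsideSector α ω) : MLDecay α β ω := by
  obtain ⟨N, hN⟩ := exists_nat_ge (3 - β)
  suffices ∀ k : ℕ, MLDecay α (β + N - k) ω by simpa using this N
  intro k
  induction k with
  | zero => exact mlDecay_of_three_le hα0 hα1 (by simp; linarith) hω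
  | succ k ih =>
    have := ih.sub_one hα0
    rwa [show β + N - k - 1 = β + N - (k + 1 : ℕ) by push_cast; ring] at this

theorem AdmissibleLambda.outsideSector {α : ℝ} {lam : ℂ} (hα0 : 0 < α) (hα1 : α ≤ 1)
    (h : AdmissibleLambda α lam) : OutsideSector α (-lam) := by
  unfold OutsideSector
  have hπ := Real.pi_pos
  rcases h with ⟨l, hl, rfl⟩ | ⟨θ, h1, h2, h3, h4⟩
  · have : 0 ≤ Real.cos (Real.pi * α / 2) := Real.cos_nonneg_of_neg_pi_div_two_le_of_le
      (by nlinarith) (by nlinarith)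
    have h2 : 0 ≤ ‖-(l : ℂ)‖ * Real.cos (Real.pi * α / 2) := by positivity
    refine lt_of_lt_of_le ?_ h2
    simpa using hl
  · have hθ : 0 < θ := lt_trans (by positivity) h1
    have hne : -lam ≠ 0 := by
      intro h0
      rw [h0, Complex.arg_zero, abs_zero] at h3
      linarith
    rw [← Complex.norm_mul_cos_arg (-lam), ← Real.cos_abs (Complex.arg _)]
    refine mul_lt_mul_of_pos_left ?_ (norm_pos_iff.2 hne)
    exact Real.cos_lt_cos_of_nonneg_of_le_pi (by positivity) h4 (by linarith)

theorem exists_norm_mittagLeffler_le {α : ℝ} (β : ℝ) {lam : ℂ} (hα0 : 0 < α) (hα1 : α ≤ 1)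
    (h : AdmissibleLambda α lam) :
    ∃ C > 0, ∀ r : ℝ, 0 ≤ r → ‖mittagLeffler α β (-lam * r)‖ ≤ C / (1 + r) := by
  obtain ⟨δ, hδ, C, hC, hb⟩ := mlDecay β hα0 hα1 (h.outsideSector hα0 hα1)
  refine ⟨C, hC, fun r hr => ?_⟩
  rw [mul_comm]
  exact hb _ (Metric.mem_ball_self hδ) r hr

/-- Since `z E_{α,α}(z) = E_{α,0}(z)`, this is the decay at `β = 0`: in effect `E_{α,α}` decays to
order two. -/
theorem exists_mul_norm_mittagLeffler_self_le {α : ℝ} {lam : ℂ} (hα0 : 0 < α) (hα1 : α ≤ 1)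
    (h : AdmissibleLambda α lam) :
    ∃ C > 0, ∀ r : ℝ, 0 ≤ r → r * ‖mittagLeffler α α (-lam * r)‖ ≤ C / (1 + r) := by
  obtain ⟨C, hC, hb⟩ := exists_norm_mittagLeffler_le 0 hα0 hα1 h
  have hl : 0 < ‖lam‖ := by
    rw [norm_pos_iff]
    rintro rfl
    simpa [OutsideSector] using h.outsideSector hα0 hα1
  refine ⟨C / ‖lam‖, by positivity, fun r hr => ?_⟩
  have := hb r hr
  rw [mittagLeffler_zero_right hα0, norm_mul, norm_mul, norm_neg, Complex.norm_real,
    Real.norm_of_nonneg hr] at this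
  rw [div_right_comm, le_div_iff₀ hl]
  linarith

/-! ### Plancherel for integrals that converge absolutely -/

section Plancherel

variable {E : Type*} [NormedAddCommGroup E] [InnerProductSpace ℝ E] [FiniteDimensional ℝ E]
  [MeasurableSpace E] [BorelSpace E]

theorem continuous_fourierInv {f : E → ℂ} (hf : Integrable f) : Continuous (𝓕⁻ f) := by
  rw [Real.fourierInv_eq_fourier_comp_neg]
  exact VectorFourier.fourierIntegral_continuous Real.continuous_fourierChar
    (innerSL ℝ).continuous₂ hf.comp_neg

theorem norm_fourier_le_integral_norm (f : E → ℂ) (x : E) : ‖𝓕 f x‖ ≤ ∫ ξ, ‖f ξ‖ :=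
  VectorFourier.norm_fourierIntegral_le_integral_norm _ _ _ _ _

theorem norm_fourierInv_le_integral_norm (f : E → ℂ) (x : E) : ‖𝓕⁻ f x‖ ≤ ∫ ξ, ‖f ξ‖ := by
  rw [Real.fourierInv_eq_fourier_neg]
  exact norm_fourier_le_integral_norm f (-x)

theorem integral_fourierInv_mul_eq {f g : E → ℂ} (hf : Integrable f) (hg : Integrable g) :
    ∫ x, 𝓕⁻ f x * g x = ∫ x, f x * 𝓕⁻ g x := by
  have h := VectorFourier.integral_fourierIntegral_smul_eq_flip (μ := volume) (ν := volume)
    (L := -innerₗ E) Real.continuous_fourierChar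
    (continuous_fst.inner continuous_snd).neg hf hg
  have hflip : (-innerₗ E).flip = -innerₗ E := by
    ext x y
    simp [real_inner_comm]
  rw [hflip] at h
  exact h

/-- The `L²` transform is defined by extension, the other one by an integral. Tested against smooth
compactly supported functions they agree, since both move `𝓕⁻` onto the test function. -/
theorem fourierInv_toLp_ae_eq {f : E → ℂ} (hf : Integrable f) (hf2 : MemLp f 2) :
    (𝓕⁻ (hf2.toLp f) : Lp ℂ 2 (volume : Measure E)) =ᵐ[volume] 𝓕⁻ f := by
  refine ae_eq_of_integral_contDiff_smul_eq ((Lp.memLp _).locallyIntegrable (by norm_num))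
    (continuous_fourierInv hf).locallyIntegrable fun g hg hgc => ?_
  have hg₁ : HasCompactSupport (Complex.ofRealCLM ∘ g) := hgc.comp_left rfl
  have hg₂ : ContDiff ℝ ((⊤ : ℕ∞) : WithTop ℕ∞) (Complex.ofRealCLM ∘ g) := by fun_prop
  set ψ : 𝓢(E, ℂ) := hg₁.toSchwartzMap hg₂ with hψ
  have hψg : ∀ x, ψ x = (g x : ℂ) := fun x => rfl
  have h := congrArg (fun T : 𝓢'(E, ℂ) => T ψ)
    (Lp.fourierInv_toTemperedDistribution_eq (hf2.toLp f))
  simp only [TemperedDistribution.fourierInv_apply, Lp.toTemperedDistribution_apply,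
    smul_eq_mul, hψg] at h
  simp only [Complex.real_smul]
  rw [← h]
  calc ∫ x, (𝓕⁻ ψ : 𝓢(E, ℂ)) x * (hf2.toLp f : E → ℂ) x = ∫ x, 𝓕⁻ (ψ : E → ℂ) x * f x := by
        refine integral_congr_ae ?_
        filter_upwards [hf2.coeFn_toLp] with x hx
        rw [hx, SchwartzMap.fourierInv_coe]
    _ = ∫ x, (g x : ℂ) * 𝓕⁻ f x := by
        rw [integral_fourierInv_mul_eq ψ.integrable hf]
        simp only [hψg]

theorem eLpNorm_fourierInv_two {f : E → ℂ} (hf : Integrable f) (hf2 : MemLp f 2) :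
    eLpNorm (𝓕⁻ f) 2 volume = eLpNorm f 2 volume := by
  rw [← eLpNorm_congr_ae (fourierInv_toLp_ae_eq hf hf2)]
  have h : ‖(𝓕⁻ (hf2.toLp f) : Lp ℂ 2 (volume : Measure E))‖ = ‖hf2.toLp f‖ := by
    rw [← Lp.norm_fourier_eq, FourierTransform.fourier_fourierInv_eq]
  rw [Lp.norm_def, Lp.norm_toLp,
    ENNReal.toReal_eq_toReal_iff' (Lp.memLp _).2.ne hf2.2.ne] at h
  exact h

theorem memLp_fourierInv_two {f : E → ℂ} (hf : Integrable f) (hf2 : MemLp f 2) :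
    MemLp (𝓕⁻ f) 2 :=
  ⟨(continuous_fourierInv hf).aestronglyMeasurable, by
    rw [eLpNorm_fourierInv_two hf hf2]; exact hf2.2⟩

theorem integral_inner_fourierInv {f g : E → ℂ} (hf : Integrable f) (hf2 : MemLp f 2)
    (hg : Integrable g) (hg2 : MemLp g 2) :
    ∫ x, inner ℂ (𝓕⁻ f x) (𝓕⁻ g x) = ∫ ξ, inner ℂ (f ξ) (g ξ) := by
  have h : inner ℂ (𝓕⁻ (hf2.toLp f) : Lp ℂ 2 (volume : Measure E))
      (𝓕⁻ (hg2.toLp g) : Lp ℂ 2 (volume : Measure E)) = inner ℂ (hf2.toLp f) (hg2.toLp g) := by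
    rw [← Lp.inner_fourier_eq, FourierTransform.fourier_fourierInv_eq,
      FourierTransform.fourier_fourierInv_eq]
  rw [L2.inner_def, L2.inner_def] at h
  calc _ = ∫ x, inner ℂ ((𝓕⁻ (hf2.toLp f) : Lp ℂ 2 (volume : Measure E)) x)
        ((𝓕⁻ (hg2.toLp g) : Lp ℂ 2 (volume : Measure E)) x) := by
        refine integral_congr_ae ?_
        filter_upwards [fourierInv_toLp_ae_eq hf hf2, fourierInv_toLp_ae_eq hg hg2] with x h1 h2
        rw [h1, h2]
    _ = _ := by
        rw [h]
        refine integral_congr_ae ?_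
        filter_upwards [hf2.coeFn_toLp, hg2.coeFn_toLp] with x h1 h2
        rw [h1, h2]

end Plancherel

/-! ### Integrals of powers of the norm over balls -/

section RadialPowers

variable {E : Type*} [NormedAddCommGroup E] [NormedSpace ℝ E] [FiniteDimensional ℝ E]
  [MeasurableSpace E] [BorelSpace E] (μ : Measure E) [μ.IsAddHaarMeasure]

theorem integrableOn_ball_norm_rpow_neg [Nontrivial E] {a : ℝ} (ha : a < Module.finrank ℝ E) (R : ℝ) :
    IntegrableOn (fun ξ : E => ‖ξ‖ ^ (-a)) (Metric.ball 0 R) μ := by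
  have := locallyIntegrable_of_norm_le_rpow (μ := μ) (E := E) (f := fun ξ : E => ‖ξ‖ ^ (-a)) (C := 1)
    Module.finrank_pos ha (.of_forall fun ξ => by
      rw [Real.norm_of_nonneg (by positivity), one_mul])
    (measurable_norm.pow_const _).aestronglyMeasurable
  exact (this.integrableOn_isCompact (isCompact_closedBall 0 R)).mono_set Metric.ball_subset_closedBall

theorem setIntegral_ball_norm_rpow_neg {a R : ℝ} (hR : 0 < R) :
    ∫ ξ in Metric.ball (0 : E) R, ‖ξ‖ ^ (-a) ∂μ =
      R ^ (Module.finrank ℝ E - a) * ∫ ξ in Metric.ball (0 : E) 1, ‖ξ‖ ^ (-a) ∂μ := by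
  have h := Measure.integral_comp_inv_smul_of_nonneg μ
    ((Metric.ball (0 : E) 1).indicator fun ξ => ‖ξ‖ ^ (-a)) hR.le
  rw [integral_indicator Metric.isOpen_ball.measurableSet] at h
  rw [Real.rpow_sub hR, Real.rpow_natCast, div_eq_mul_inv, ← Real.rpow_neg hR.le, mul_right_comm]
  rw [smul_eq_mul] at h
  rw [← h, ← integral_mul_const, ← integral_indicator Metric.isOpen_ball.measurableSet]
  congr 1
  ext ξ
  have hmem : R⁻¹ • ξ ∈ Metric.ball (0 : E) 1 ↔ ξ ∈ Metric.ball (0 : E) R := by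
    rw [mem_ball_zero_iff, mem_ball_zero_iff, norm_smul, norm_inv, Real.norm_of_nonneg hR.le,
      inv_mul_lt_iff₀ hR, mul_one]
  by_cases hξ : ξ ∈ Metric.ball (0 : E) R
  · rw [Set.indicator_of_mem hξ, Set.indicator_of_mem (hmem.2 hξ), norm_smul, norm_inv,
      Real.norm_of_nonneg hR.le, Real.mul_rpow (by positivity) (by positivity),
      Real.inv_rpow hR.le, mul_right_comm, inv_mul_cancel₀ (by positivity), one_mul]
  · rw [Set.indicator_of_notMem hξ, Set.indicator_of_notMem (hmem.not.2 hξ), zero_mul]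

end RadialPowers

/-! ### Sobolev embedding into `L^q`, `2 < q < ∞` -/

section Sobolev

variable {E : Type*} [NormedAddCommGroup E] [InnerProductSpace ℝ E] [FiniteDimensional ℝ E]
  [MeasurableSpace E] [BorelSpace E]

/-- The function `|ξ| ^ s f(ξ)`. -/
noncomputable def normWeight (s : ℝ) (f : E → ℂ) (ξ : E) : ℂ := ((‖ξ‖ ^ s : ℝ) : ℂ) * f ξ

theorem norm_normWeight (s : ℝ) (f : E → ℂ) (ξ : E) : ‖normWeight s f ξ‖ = ‖ξ‖ ^ s * ‖f ξ‖ := by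
  rw [normWeight, norm_mul, Complex.norm_real, Real.norm_of_nonneg (by positivity)]

theorem enorm_normWeight (s : ℝ) (f : E → ℂ) (ξ : E) :
    ‖normWeight s f ξ‖ₑ = ENNReal.ofReal (‖ξ‖ ^ s) * ‖f ξ‖ₑ := by
  rw [← ofReal_norm, norm_normWeight, ENNReal.ofReal_mul (by positivity), ofReal_norm]

theorem aestronglyMeasurable_normWeight (s : ℝ) {f : E → ℂ} (hf : AEStronglyMeasurable f) :
    AEStronglyMeasurable (normWeight s f) := by
  refine AEStronglyMeasurable.mul ?_ hf
  exact (Complex.measurable_ofReal.comp (measurable_norm.pow_const s)).aestronglyMeasurable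

theorem eLpNorm_two_sq {f : E → ℂ} {μ : Measure E} :
    eLpNorm f 2 μ ^ 2 = ∫⁻ ξ, ‖f ξ‖ₑ ^ 2 ∂μ := by
  have := eLpNorm_nnreal_pow_eq_lintegral (μ := μ) (f := f) (p := 2) (by norm_num)
  simpa using this

theorem ae_ne_zero [Nontrivial E] : ∀ᵐ ξ : E, ξ ≠ 0 := by
  simp [ae_iff]

/-- Cauchy–Schwarz on the ball for `|f| = |ξ|^{-s} · |ξ|^s |f|`; the square of the first factor is
integrable at `0` exactly because `2s < n`. -/
theorem lintegral_ball_enorm_le [Nontrivial E] {s : ℝ} (hs : 2 * s < Module.finrank ℝ E) {f : E → ℂ}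
    (hf : AEStronglyMeasurable f) {R : ℝ} (hR : 0 < R) :
    ∫⁻ ξ in Metric.ball 0 R, ‖f ξ‖ₑ ≤
      ENNReal.ofReal (√(∫ ξ in Metric.ball (0 : E) 1, ‖ξ‖ ^ (-(2 * s))) *
        R ^ ((Module.finrank ℝ E : ℝ) / 2 - s)) * eLpNorm (normWeight s f) 2 volume := by
  set ν := (volume : Measure E).restrict (Metric.ball 0 R)
  have h1 : eLpNorm (fun ξ : E => ((‖ξ‖ ^ (-s) : ℝ) : ℂ)) 2 ν =
      ENNReal.ofReal (√(∫ ξ in Metric.ball (0 : E) 1, ‖ξ‖ ^ (-(2 * s))) *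
        R ^ ((Module.finrank ℝ E : ℝ) / 2 - s)) := by
    refine ENNReal.rpow_left_injective (x := 2) two_ne_zero ?_
    dsimp only
    rw [ENNReal.rpow_two, ENNReal.rpow_two, eLpNorm_two_sq,
      ← ENNReal.ofReal_pow (by positivity), mul_pow, Real.sq_sqrt (integral_nonneg fun ξ => by positivity),
      ← Real.rpow_mul_natCast hR.le]
    rw [show ((Module.finrank ℝ E : ℝ) / 2 - s) * (2 : ℕ) = Module.finrank ℝ E - 2 * s by
      push_cast; ring, mul_comm, ← setIntegral_ball_norm_rpow_neg volume hR,
      ofReal_integral_eq_lintegral_ofReal (integrableOn_ball_norm_rpow_neg volume hs R)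
        (.of_forall fun ξ => by positivity)]
    refine lintegral_congr fun ξ => ?_
    rw [← ofReal_norm, ← ENNReal.ofReal_pow (norm_nonneg _), Complex.norm_real,
      Real.norm_of_nonneg (by positivity), ← Real.rpow_mul_natCast (norm_nonneg _)]
    congr 2
    push_cast
    ring
  have h2 : eLpNorm (normWeight s f) 2 ν ≤ eLpNorm (normWeight s f) 2 volume :=
    eLpNorm_mono_measure _ Measure.restrict_le_self
  rw [← h1]
  calc ∫⁻ ξ, ‖f ξ‖ₑ ∂ν = eLpNorm ((fun ξ : E => ((‖ξ‖ ^ (-s) : ℝ) : ℂ)) • normWeight s f) 1 ν := by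
        rw [eLpNorm_one_eq_lintegral_enorm]
        refine lintegral_congr_ae (ae_restrict_of_ae ?_)
        filter_upwards [ae_ne_zero] with ξ hξ
        have : ‖ξ‖ ^ (-s) * ‖ξ‖ ^ s = 1 := by
          rw [← Real.rpow_add (norm_pos_iff.2 hξ)]; simp
        simp only [Pi.smul_apply', smul_eq_mul, normWeight]
        rw [← mul_assoc, ← Complex.ofReal_mul, this]
        simp
    _ ≤ eLpNorm (fun ξ : E => ((‖ξ‖ ^ (-s) : ℝ) : ℂ)) 2 ν * eLpNorm (normWeight s f) 2 ν := by
        refine eLpNorm_smul_le_mul_eLpNorm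
          (aestronglyMeasurable_normWeight s hf).restrict ?_
        exact (Complex.measurable_ofReal.comp (measurable_norm.pow_const _)).aestronglyMeasurable
    _ ≤ _ := by gcongr

/-- Splitting the frequencies at the level set of a power of `|ξ|`, chosen so that the low
frequencies contribute at most `l / 2`. -/
theorem volume_lt_norm_fourierInv_le [Nontrivial E] {q : ℝ} (hq : 2 < q) {f : E → ℂ}
    (hf : Integrable f) {B l : ℝ} (hB : 0 < B) (hl : 0 < l)
    (hw : MemLp (normWeight ((Module.finrank ℝ E : ℝ) / 2 - Module.finrank ℝ E / q) f) 2)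
    (hlow : ∀ R > 0, ∫⁻ ξ in Metric.ball 0 R, ‖f ξ‖ₑ ≤
      ENNReal.ofReal (B / 2 * R ^ ((Module.finrank ℝ E : ℝ) / q))) :
    volume {x | l < ‖𝓕⁻ f x‖} ≤
      ENNReal.ofReal (4 * l ^ (-2 : ℝ)) * ∫⁻ ξ, (Set.Iic (B * ‖ξ‖ ^ ((Module.finrank ℝ E : ℝ) / q))).indicator
        (fun _ => ‖f ξ‖ₑ ^ 2) l := by
  have hd : (0 : ℝ) < Module.finrank ℝ E := by exact_mod_cast Module.finrank_pos
  set d := (Module.finrank ℝ E : ℝ) with hdd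
  have hq0 : 0 < q := by linarith
  set s := d / 2 - d / q with hs
  have hs0 : 0 < s := by
    rw [hs, sub_pos]
    exact div_lt_div_of_pos_left hd (by norm_num) hq
  set R : ℝ := (l / B) ^ (q / d) with hR
  have hR0 : 0 < R := by positivity
  have hRd : R ^ (d / q) = l / B := by
    rw [hR, ← Real.rpow_mul (by positivity), show q / d * (d / q) = 1 by field_simp, Real.rpow_one]
  have hset : ∀ ξ : E, l ≤ B * ‖ξ‖ ^ (d / q) ↔ ξ ∉ Metric.ball (0 : E) R := by
    intro ξ
    rw [mem_ball_zero_iff, not_lt, ← div_le_iff₀' hB, ← hRd,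
      Real.rpow_le_rpow_iff hR0.le (norm_nonneg _) (by positivity)]
  set f₁ : E → ℂ := (Metric.ball 0 R).indicator f with hf₁
  set f₂ : E → ℂ := (Metric.ball 0 R)ᶜ.indicator f with hf₂
  have hf₁i : Integrable f₁ := hf.indicator Metric.isOpen_ball.measurableSet
  have hf₂i : Integrable f₂ := hf.indicator Metric.isOpen_ball.measurableSet.compl
  have hadd : ∀ x, 𝓕⁻ f x = 𝓕⁻ f₁ x + 𝓕⁻ f₂ x := by
    intro x
    have : f = f₁ + f₂ := by rw [hf₁, hf₂, Set.indicator_self_add_compl]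
    conv_lhs => rw [this]
    exact congrFun (VectorFourier.fourierIntegral_add Real.continuous_fourierChar
      (L := -innerₗ E) (continuous_fst.inner continuous_snd).neg hf₁i hf₂i) x
  have hf₁b : ∀ x, ‖𝓕⁻ f₁ x‖ ≤ l / 2 := by
    intro x
    refine (norm_fourierInv_le_integral_norm f₁ x).trans ?_
    rw [integral_norm_eq_lintegral_enorm hf₁i.1]
    refine ENNReal.toReal_le_of_le_ofReal (by positivity) ?_
    have : ∀ ξ, ‖f₁ ξ‖ₑ = (Metric.ball 0 R).indicator (fun ξ => ‖f ξ‖ₑ) ξ := fun ξ => by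
      rw [hf₁, enorm_indicator_eq_indicator_enorm]
    simp only [this]
    rw [lintegral_indicator Metric.isOpen_ball.measurableSet]
    refine (hlow R hR0).trans_eq ?_
    rw [hRd]
    congr 1
    field_simp
  have hf₂2 : MemLp f₂ 2 := by
    refine (hw.const_mul ((R ^ (-s) : ℝ) : ℂ)).of_le hf₂i.1 (.of_forall fun ξ => ?_)
    rw [norm_mul, norm_normWeight, Complex.norm_real, Real.norm_of_nonneg (by positivity),
      hf₂]
    by_cases hξ : ξ ∈ Metric.ball (0 : E) R
    · rw [Set.indicator_of_notMem (by simpa using hξ), norm_zero]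
      positivity
    · rw [Set.indicator_of_mem (by simpa using hξ), ← mul_assoc]
      refine le_mul_of_one_le_left (norm_nonneg _) ?_
      rw [mem_ball_zero_iff, not_lt] at hξ
      rw [Real.rpow_neg hR0.le, ← div_eq_inv_mul, one_le_div (by positivity)]
      gcongr
  have hsub : {x | l < ‖𝓕⁻ f x‖} ⊆ {x | ENNReal.ofReal (l / 2) ≤ ‖𝓕⁻ f₂ x‖ₑ} := by
    intro x hx
    simp only [Set.mem_ofPred_eq] at hx ⊢
    rw [← ofReal_norm]
    refine ENNReal.ofReal_le_ofReal ?_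
    have := norm_add_le (𝓕⁻ f₁ x) (𝓕⁻ f₂ x)
    rw [← hadd] at this
    linarith [hf₁b x]
  refine (measure_mono hsub).trans ?_
  have hch := meas_ge_le_mul_pow_eLpNorm_enorm (volume : Measure E) (p := 2) (by norm_num) (by norm_num)
    (memLp_fourierInv_two hf₂i hf₂2).1 (ε := ENNReal.ofReal (l / 2))
    (by simpa using hl) (by simp)
  refine hch.trans_eq ?_
  rw [eLpNorm_fourierInv_two hf₂i hf₂2]
  simp only [ENNReal.toReal_ofNat, ENNReal.rpow_ofNat]
  rw [eLpNorm_two_sq, ← ENNReal.ofReal_inv_of_pos (by positivity), ← ENNReal.ofReal_pow (by positivity)]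
  congr 2
  · rw [Real.rpow_neg hl.le]
    norm_cast
    field_simp
    norm_num
  · ext ξ
    by_cases hξ : ξ ∈ Metric.ball (0 : E) R
    · rw [Set.indicator_of_notMem (by rw [Set.mem_Iic, hset]; simpa using hξ), hf₂,
        Set.indicator_of_notMem (by simpa using hξ)]
      simp
    · rw [Set.indicator_of_mem (by rw [Set.mem_Iic, hset]; exact hξ), hf₂,
        Set.indicator_of_mem (by simpa using hξ)]

/-- The layer-cake formula followed by Tonelli. At fixed `ξ` only levels `l ≤ B|ξ|^{d/q}` count, and
integrating `l^{q-3}` up to there (convergent since `q > 2`) gives `|ξ|^{(q-2)d/q} = |ξ|^{2s}` with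
`s = d/2 - d/q`, the square of the Sobolev weight. -/
theorem lintegral_enorm_fourierInv_rpow_le [Nontrivial E] {q : ℝ} (hq : 2 < q) {f : E → ℂ}
    (hf : Integrable f) {B : ℝ} (hB : 0 < B)
    (hw : MemLp (normWeight ((Module.finrank ℝ E : ℝ) / 2 - Module.finrank ℝ E / q) f) 2)
    (hlow : ∀ R > 0, ∫⁻ ξ in Metric.ball 0 R, ‖f ξ‖ₑ ≤
      ENNReal.ofReal (B / 2 * R ^ ((Module.finrank ℝ E : ℝ) / q))) :
    ∫⁻ x, ENNReal.ofReal (‖𝓕⁻ f x‖ ^ q) ≤ ENNReal.ofReal (4 * q / (q - 2) * B ^ (q - 2)) *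
      eLpNorm (normWeight ((Module.finrank ℝ E : ℝ) / 2 - Module.finrank ℝ E / q) f) 2 volume ^ 2 := by
  have hd : (0 : ℝ) < Module.finrank ℝ E := by exact_mod_cast Module.finrank_pos
  set d := (Module.finrank ℝ E : ℝ) with hdd
  have hq0 : 0 < q := by linarith
  have hmeas : Measurable fun z : ℝ × E => ENNReal.ofReal (4 * z.1 ^ (-2 : ℝ) * z.1 ^ (q - 1)) := by
    fun_prop
  have hS : MeasurableSet {z : ℝ × E | z.1 ≤ B * ‖z.2‖ ^ (d / q)} :=
    measurableSet_le measurable_fst (by fun_prop)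
  rw [lintegral_rpow_eq_lintegral_meas_lt_mul volume (.of_forall fun x => norm_nonneg _)
    (continuous_fourierInv hf).norm.aemeasurable hq0]
  set Φ : ℝ → E → ℝ≥0∞ := fun l ξ => ENNReal.ofReal (4 * l ^ (-2 : ℝ) * l ^ (q - 1)) *
    (Set.Iic (B * ‖ξ‖ ^ (d / q))).indicator (fun _ => ‖f ξ‖ₑ ^ 2) l with hΦ
  have hΦm : AEMeasurable (Function.uncurry Φ) ((volume.restrict (Set.Ioi 0)).prod volume) := by
    refine hmeas.aemeasurable.mul ?_
    have h1 : AEMeasurable (fun z : ℝ × E => ‖f z.2‖ₑ ^ 2)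
        ((volume.restrict (Set.Ioi (0 : ℝ))).prod volume) :=
      (hf.1.enorm.pow_const 2).comp_snd
    exact h1.indicator hS
  have h1 : ∫⁻ l in Set.Ioi 0, volume {x | l < ‖𝓕⁻ f x‖} * ENNReal.ofReal (l ^ (q - 1)) ≤
      ∫⁻ l in Set.Ioi 0, ∫⁻ ξ, Φ l ξ := by
    refine setLIntegral_mono_ae' measurableSet_Ioi (.of_forall fun l hl => ?_)
    have hl0 : (0 : ℝ) < l := hl
    rw [hΦ]
    dsimp only
    rw [lintegral_const_mul' _ _ ENNReal.ofReal_ne_top, ENNReal.ofReal_mul (by positivity),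
      mul_right_comm]
    gcongr
    exact volume_lt_norm_fourierInv_le hq hf hB hl0 hw hlow
  have h2 : ∀ ξ : E, ξ ≠ 0 → ∫⁻ l in Set.Ioi 0, Φ l ξ =
      ENNReal.ofReal (4 / (q - 2) * B ^ (q - 2)) * ‖normWeight (d / 2 - d / q) f ξ‖ₑ ^ 2 := by
    intro ξ hξ
    have hξ0 : 0 < ‖ξ‖ := norm_pos_iff.2 hξ
    set L := B * ‖ξ‖ ^ (d / q) with hL
    have hL0 : 0 < L := by positivity
    have e1 : ∀ l, Φ l ξ = (Set.Iic L).indicator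
        (fun l => ENNReal.ofReal (4 * l ^ (-2 : ℝ) * l ^ (q - 1)) * ‖f ξ‖ₑ ^ 2) l := by
      intro l
      simp only [hΦ]
      by_cases hl : l ∈ Set.Iic L
      · rw [Set.indicator_of_mem hl, Set.indicator_of_mem hl]
      · rw [Set.indicator_of_notMem hl, Set.indicator_of_notMem hl, mul_zero]
    simp only [e1]
    rw [lintegral_indicator measurableSet_Iic, Measure.restrict_restrict measurableSet_Iic,
      Set.inter_comm, Set.Ioi_inter_Iic, lintegral_mul_const _ (by fun_prop)]
    have e2 : ∫⁻ l in Set.Ioc 0 L, ENNReal.ofReal (4 * l ^ (-2 : ℝ) * l ^ (q - 1)) =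
        ENNReal.ofReal (4 / (q - 2) * L ^ (q - 2)) := by
      have e3 : ∫⁻ l in Set.Ioc 0 L, ENNReal.ofReal (4 * l ^ (-2 : ℝ) * l ^ (q - 1)) =
          ∫⁻ l in Set.Ioc 0 L, ENNReal.ofReal (4 * l ^ (q - 3)) := by
        refine setLIntegral_congr_fun measurableSet_Ioc fun l hl => ?_
        rw [mul_assoc, ← Real.rpow_add hl.1]
        congr 3
        ring
      have hint : IntervalIntegrable (fun l : ℝ => 4 * l ^ (q - 3)) volume 0 L :=
        (intervalIntegral.intervalIntegrable_rpow' (by linarith)).const_mul 4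
      rw [e3, ← ofReal_integral_eq_lintegral_ofReal
        ((intervalIntegrable_iff_integrableOn_Ioc_of_le hL0.le).1 hint),
        ← intervalIntegral.integral_of_le hL0.le, intervalIntegral.integral_const_mul,
        integral_rpow (Or.inl (by linarith)), Real.zero_rpow (by linarith)]
      · congr 1
        rw [show q - 3 + 1 = q - 2 by ring]
        ring
      · refine (ae_restrict_mem measurableSet_Ioc).mono fun l hl => ?_
        have : 0 < l := hl.1
        positivity
    rw [e2, enorm_normWeight, mul_pow, ← mul_assoc, ← ENNReal.ofReal_pow (by positivity),
      ← ENNReal.ofReal_mul (by have : 0 < q - 2 := by linarith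
                               positivity)]
    congr 2
    rw [hL, Real.mul_rpow hB.le (by positivity), ← Real.rpow_mul hξ0.le,
      ← Real.rpow_mul_natCast hξ0.le, mul_assoc]
    congr 3
    push_cast
    field_simp
  calc _ ≤ ENNReal.ofReal q * ∫⁻ l in Set.Ioi 0, ∫⁻ ξ, Φ l ξ := by gcongr
    _ = ENNReal.ofReal q * ∫⁻ ξ, ∫⁻ l in Set.Ioi 0, Φ l ξ := by
        rw [lintegral_lintegral_swap hΦm]
    _ = ENNReal.ofReal q * (ENNReal.ofReal (4 / (q - 2) * B ^ (q - 2)) *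
          ∫⁻ ξ, ‖normWeight (d / 2 - d / q) f ξ‖ₑ ^ 2) := by
        congr 1
        rw [← lintegral_const_mul' _ _ ENNReal.ofReal_ne_top]
        refine lintegral_congr_ae ?_
        filter_upwards [ae_ne_zero] with ξ hξ
        exact h2 ξ hξ
    _ = _ := by
        rw [eLpNorm_two_sq, ← mul_assoc, ← ENNReal.ofReal_mul hq0.le]
        congr 2
        ring

/-- The Sobolev embedding `Ḣ^s ⊂ L^q`, `s = n/2 - n/q`, on the Fourier side. -/
theorem exists_eLpNorm_fourierInv_le [Nontrivial E] {q : ℝ} (hq : 2 < q) :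
    ∃ C > 0, ∀ f : E → ℂ, Integrable f →
      eLpNorm (𝓕⁻ f) (ENNReal.ofReal q) volume ≤ ENNReal.ofReal C *
        eLpNorm (normWeight ((Module.finrank ℝ E : ℝ) / 2 - Module.finrank ℝ E / q) f) 2 volume := by
  have hd : (0 : ℝ) < Module.finrank ℝ E := by exact_mod_cast Module.finrank_pos
  have hq0 : 0 < q := by linarith
  have hq2 : 0 < q - 2 := by linarith
  set d := (Module.finrank ℝ E : ℝ) with hdd
  set s := d / 2 - d / q with hs
  set K := √(∫ ξ in Metric.ball (0 : E) 1, ‖ξ‖ ^ (-(2 * s))) + 1 with hK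
  have hK0 : 0 < K := by positivity
  set C₀ := 4 * q / (q - 2) * (2 * K) ^ (q - 2) with hC₀
  have hC₀0 : 0 < C₀ := by positivity
  refine ⟨C₀ ^ (1 / q), by positivity, fun f hf => ?_⟩
  set N := eLpNorm (normWeight s f) 2 volume with hN
  have hm := aestronglyMeasurable_normWeight s hf.1
  -- The threshold constant used below is proportional to `N` and has to be positive and finite, so
  -- the two degenerate values are treated apart.
  rcases eq_or_ne N 0 with h0 | h0
  · have hz : f =ᵐ[volume] 0 := by
      have := (eLpNorm_eq_zero_iff hm (by norm_num)).1 h0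
      filter_upwards [this, ae_ne_zero] with ξ hξ hξ0
      simpa [normWeight, (Real.rpow_pos_of_pos (norm_pos_iff.2 hξ0) s).ne'] using hξ
    have : 𝓕⁻ f = 0 := by
      ext x
      rw [Real.fourierInv_congr_ae hz]
      simp [Real.fourierInv_eq]
    simp [this]
  rcases eq_or_ne N ∞ with ht | ht
  · rw [ht, ENNReal.mul_top (by simpa using by positivity)]
    exact le_top
  set H := N.toReal with hH
  have hH0 : 0 < H := ENNReal.toReal_pos h0 ht
  have hNH : N = ENNReal.ofReal H := (ENNReal.ofReal_toReal ht).symm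
  have hw : MemLp (normWeight s f) 2 := ⟨hm, ht.lt_top⟩
  -- The low-frequency bound is at most `K H R^{d/q}`, which dictates `B = 2KH`; then `B^{q-2} H²`
  -- is a multiple of `H^q`, as homogeneity requires.
  have hmain := lintegral_enorm_fourierInv_rpow_le hq hf (B := 2 * K * H) (by positivity) hw ?_
  swap
  · intro R hR
    refine (lintegral_ball_enorm_le (s := s) ?_ hf.1 hR).trans ?_
    · rw [hs]
      have : 0 < d / q := by positivity
      linarith
    · rw [← hN, hNH, ← ENNReal.ofReal_mul (by positivity)]
      refine ENNReal.ofReal_le_ofReal ?_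
      rw [show d / 2 - s = d / q by rw [hs]; ring]
      calc _ ≤ K * R ^ (d / q) * H := by
            gcongr
            rw [hK]
            linarith
        _ = _ := by ring
  rw [← hN, hNH, ← ENNReal.ofReal_pow hH0.le, ← ENNReal.ofReal_mul (by positivity)] at hmain
  rw [eLpNorm_eq_lintegral_rpow_enorm_toReal (by simpa using hq0) ENNReal.ofReal_ne_top,
    ENNReal.toReal_ofReal hq0.le, hNH, ← ENNReal.ofReal_mul (by positivity)]
  have hconv : ∀ x, ‖𝓕⁻ f x‖ₑ ^ q = ENNReal.ofReal (‖𝓕⁻ f x‖ ^ q) := fun x => by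
    rw [← ofReal_norm, ENNReal.ofReal_rpow_of_nonneg (norm_nonneg _) hq0.le]
  simp only [hconv]
  calc _ ≤ (ENNReal.ofReal (4 * q / (q - 2) * (2 * K * H) ^ (q - 2) * H ^ 2)) ^ (1 / q) := by
        gcongr
    _ = ENNReal.ofReal (C₀ ^ (1 / q) * H) := by
        rw [ENNReal.ofReal_rpow_of_nonneg (by positivity) (by positivity)]
        congr 1
        have : 4 * q / (q - 2) * (2 * K * H) ^ (q - 2) * H ^ 2 = C₀ * H ^ q := by
          rw [Real.mul_rpow (by positivity) hH0.le, hC₀]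
          have : H ^ q = H ^ (q - 2) * H ^ 2 := by
            rw [← Real.rpow_natCast, ← Real.rpow_add hH0]
            norm_num
          rw [this]
          ring
        rw [this, Real.mul_rpow hC₀0.le (by positivity), ← Real.rpow_mul hH0.le]
        rw [mul_one_div_cancel hq0.ne', Real.rpow_one]

end Sobolev

/-! ### The dual embedding and multipliers from `L^p` to `L^q` -/

section DualSobolev

variable {E : Type*} [NormedAddCommGroup E] [InnerProductSpace ℝ E] [FiniteDimensional ℝ E]
  [MeasurableSpace E] [BorelSpace E]

theorem enorm_integral_inner_le {p p' : ℝ} (hpp : p'.HolderConjugate p) {f g : E → ℂ}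
    (hf : AEStronglyMeasurable f) (hg : AEStronglyMeasurable g) :
    ‖∫ x, inner ℂ (f x) (g x)‖ₑ ≤
      eLpNorm f (ENNReal.ofReal p') volume * eLpNorm g (ENNReal.ofReal p) volume := by
  calc _ ≤ ∫⁻ x, ‖inner ℂ (f x) (g x)‖ₑ := enorm_integral_le_lintegral_enorm _
    _ ≤ ∫⁻ x, ‖f x‖ₑ * ‖g x‖ₑ := by
        refine lintegral_mono fun x => ?_
        rw [← ofReal_norm, ← ofReal_norm (f x), ← ofReal_norm (g x),
          ← ENNReal.ofReal_mul (norm_nonneg _)]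
        exact ENNReal.ofReal_le_ofReal (norm_inner_le_norm _ _)
    _ ≤ _ := by
        refine (ENNReal.lintegral_mul_le_Lp_mul_Lq volume hpp hf.enorm hg.enorm).trans_eq ?_
        rw [eLpNorm_eq_lintegral_rpow_enorm_toReal (by simpa using hpp.pos) ENNReal.ofReal_ne_top,
          eLpNorm_eq_lintegral_rpow_enorm_toReal (by simpa using hpp.symm.pos)
            ENNReal.ofReal_ne_top, ENNReal.toReal_ofReal hpp.pos.le,
          ENNReal.toReal_ofReal hpp.symm.pos.le]

theorem norm_indicator_normWeight_neg_le {s ε : ℝ} (hs : 0 ≤ s) (hε : 0 < ε) (G : E → ℂ) (ξ : E) :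
    ‖(Metric.ball (0 : E) ε)ᶜ.indicator (normWeight (-s) G) ξ‖ ≤ ‖((ε ^ (-s) : ℝ) : ℂ) * G ξ‖ := by
  rw [norm_mul, Complex.norm_real, Real.norm_of_nonneg (by positivity)]
  by_cases hξ : ξ ∈ Metric.ball (0 : E) ε
  · rw [Set.indicator_of_notMem (by simpa using hξ), norm_zero]
    positivity
  · rw [Set.indicator_of_mem (by simpa using hξ), norm_normWeight]
    rw [mem_ball_zero_iff, not_lt] at hξ
    gcongr ?_ * _
    exact Real.rpow_le_rpow_of_nonpos hε hξ (by linarith)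

/-- The embedding `L^p ⊂ Ḣ^{-s}`, `s = n/p - n/2`, on the Fourier side; it is dual to
`exists_eLpNorm_fourierInv_le`. -/
theorem exists_eLpNorm_normWeight_neg_le [Nontrivial E] {p : ℝ} (hp1 : 1 < p) (hp2 : p < 2) :
    ∃ C > 0, ∀ G : E → ℂ, Integrable G → MemLp G 2 →
      eLpNorm (normWeight (-((Module.finrank ℝ E : ℝ) / p - Module.finrank ℝ E / 2)) G) 2 volume ≤
        ENNReal.ofReal C * eLpNorm (𝓕⁻ G) (ENNReal.ofReal p) volume := by
  have hd : (0 : ℝ) < Module.finrank ℝ E := by exact_mod_cast Module.finrank_pos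
  set d := (Module.finrank ℝ E : ℝ) with hdd
  have hpp : p.HolderConjugate (p / (p - 1)) := Real.HolderConjugate.conjExponent hp1
  have hp'2 : 2 < p / (p - 1) := by
    rw [lt_div_iff₀ (by linarith)]
    linarith
  obtain ⟨C, hC, hB⟩ := exists_eLpNorm_fourierInv_le (E := E) hp'2
  have hse : d / 2 - d / (p / (p - 1)) = d / p - d / 2 := by
    have : p - 1 ≠ 0 := by linarith
    field_simp
    ring
  rw [← hdd, hse] at hB
  set s := d / p - d / 2 with hs
  have hs0 : 0 < s := by
    rw [hs, sub_pos]
    exact div_lt_div_of_pos_left hd (by linarith) hp2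
  refine ⟨C, hC, fun G hG hG2 => ?_⟩
  have hmain : ∀ ε > 0, eLpNorm ((Metric.ball (0 : E) ε)ᶜ.indicator (normWeight (-s) G)) 2 volume ≤
      ENNReal.ofReal C * eLpNorm (𝓕⁻ G) (ENNReal.ofReal p) volume := by
    intro ε hε
    have hSm : MeasurableSet (Metric.ball (0 : E) ε)ᶜ := Metric.isOpen_ball.measurableSet.compl
    set W := (Metric.ball (0 : E) ε)ᶜ.indicator (normWeight (-s) G) with hW
    -- The extremal test function for duality: `|ξ|^s H = W` and `⟨H, G⟩ = |W|²`. Removing a ball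
    -- about `0` keeps the negative powers bounded, so `H` is integrable and square integrable.
    set H := (Metric.ball (0 : E) ε)ᶜ.indicator (normWeight (-(2 * s)) G) with hH
    have hHm : AEStronglyMeasurable H := (aestronglyMeasurable_normWeight _ hG.1).indicator hSm
    have hWm : AEStronglyMeasurable W := (aestronglyMeasurable_normWeight _ hG.1).indicator hSm
    have hHi : Integrable H := (hG.const_mul _).mono hHm
      (.of_forall (norm_indicator_normWeight_neg_le (s := 2 * s) (by positivity) hε G))
    have hH2 : MemLp H 2 := (hG2.const_mul _).of_le hHm
      (.of_forall (norm_indicator_normWeight_neg_le (s := 2 * s) (by positivity) hε G))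
    have hW2 : MemLp W 2 := (hG2.const_mul _).of_le hWm
      (.of_forall (norm_indicator_normWeight_neg_le hs0.le hε G))
    have hsH : normWeight s H = W := by
      ext ξ
      by_cases hξ : ξ ∈ Metric.ball (0 : E) ε
      · rw [normWeight, hH, hW, Set.indicator_of_notMem (by simpa using hξ),
          Set.indicator_of_notMem (by simpa using hξ), mul_zero]
      · rw [normWeight, hH, hW, Set.indicator_of_mem (by simpa using hξ),
          Set.indicator_of_mem (by simpa using hξ), normWeight, normWeight, ← mul_assoc,
          ← Complex.ofReal_mul]
        rw [mem_ball_zero_iff, not_lt] at hξ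
        rw [← Real.rpow_add (hε.trans_le hξ)]
        congr 3
        ring
    have hinner : ∀ ξ, inner ℂ (H ξ) (G ξ) = ((‖W ξ‖ ^ 2 : ℝ) : ℂ) := by
      intro ξ
      by_cases hξ : ξ ∈ Metric.ball (0 : E) ε
      · rw [hH, hW, Set.indicator_of_notMem (by simpa using hξ),
          Set.indicator_of_notMem (by simpa using hξ)]
        simp
      · rw [hH, hW, Set.indicator_of_mem (by simpa using hξ),
          Set.indicator_of_mem (by simpa using hξ), norm_normWeight, normWeight]
        rw [mem_ball_zero_iff, not_lt] at hξ
        rw [mul_pow, ← Real.rpow_mul_natCast (norm_nonneg _),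
          show -s * (2 : ℕ) = -(2 * s) by push_cast; ring, RCLike.inner_apply, map_mul,
          Complex.conj_ofReal, mul_left_comm, Complex.mul_conj, Complex.normSq_eq_norm_sq]
        push_cast
        rfl
    have hY : ‖∫ x, inner ℂ (𝓕⁻ H x) (𝓕⁻ G x)‖ₑ = eLpNorm W 2 volume ^ 2 := by
      rw [integral_inner_fourierInv hHi hH2 hG hG2]
      simp only [hinner]
      rw [integral_complex_ofReal, ← ofReal_norm, Complex.norm_real, Real.norm_of_nonneg
        (integral_nonneg fun ξ => by positivity), eLpNorm_two_sq,
        ofReal_integral_eq_lintegral_ofReal ((memLp_two_iff_integrable_sq_norm hWm).1 hW2)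
          (.of_forall fun ξ => by positivity)]
      refine lintegral_congr fun ξ => ?_
      rw [ENNReal.ofReal_pow (norm_nonneg _), ofReal_norm]
    have h1 := enorm_integral_inner_le hpp.symm (continuous_fourierInv hHi).aestronglyMeasurable
      (continuous_fourierInv hG).aestronglyMeasurable
    rw [hY] at h1
    have h2 := hB H hHi
    rw [hsH] at h2
    set Y := eLpNorm W 2 volume with hYd
    -- Hölder and the Sobolev embedding for `H` give `Y² ≤ C Y ‖𝓕⁻ G‖_p`; dividing by `Y` needs `Y`
    -- nonzero and finite, and finiteness is again due to the cut-off.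
    rcases eq_or_ne Y 0 with h0 | h0
    · rw [h0]
      exact zero_le
    have h3 : Y * Y ≤ Y * (ENNReal.ofReal C * eLpNorm (𝓕⁻ G) (ENNReal.ofReal p) volume) := by
      calc Y * Y = Y ^ 2 := (sq Y).symm
        _ ≤ _ := h1
        _ ≤ ENNReal.ofReal C * Y * eLpNorm (𝓕⁻ G) (ENNReal.ofReal p) volume := by gcongr
        _ = _ := by ring
    exact (ENNReal.mul_le_mul_iff_right h0 hW2.2.ne).1 h3
  -- Fatou's lemma removes the cut-off, because the bound does not depend on `ε`.
  have hlim := Lp.eLpNorm_lim_le_liminf_eLpNorm (p := 2) (μ := volume)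
    (f := fun (k : ℕ) => (Metric.ball (0 : E) (1 / ((k : ℝ) + 1)))ᶜ.indicator (normWeight (-s) G))
    (fun k => (aestronglyMeasurable_normWeight _ hG.1).indicator
      Metric.isOpen_ball.measurableSet.compl) (normWeight (-s) G) ?_
  · refine hlim.trans (Filter.liminf_le_of_le (by isBoundedDefault) fun b hb => ?_)
    obtain ⟨k, hk⟩ := hb.exists
    exact hk.trans (hmain _ (by positivity))
  · filter_upwards [ae_ne_zero] with ξ hξ
    have hξ0 : 0 < ‖ξ‖ := norm_pos_iff.2 hξ
    refine tendsto_const_nhds.congr' ?_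
    filter_upwards [(tendsto_one_div_add_atTop_nhds_zero_nat (𝕜 := ℝ)).eventually_lt_const hξ0]
      with k hk
    rw [Set.indicator_of_mem]
    simpa using hk.le

/-- Fourier multipliers dominated by `|ξ| ^ (-a)`, `a = n/p - n/q`, map `L^p` to `L^q`. -/
theorem exists_eLpNorm_fourierInv_le_of_norm_le [Nontrivial E] {p q : ℝ} (hp1 : 1 < p)
    (hp2 : p < 2) (hq : 2 < q) :
    ∃ C > 0, ∀ (G V : E → ℂ) (K : ℝ), 0 ≤ K → Integrable G → MemLp G 2 → Integrable V →
      (∀ ξ, ξ ≠ 0 → ‖V ξ‖ ≤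
        K * ‖ξ‖ ^ (-((Module.finrank ℝ E : ℝ) / p - Module.finrank ℝ E / q)) * ‖G ξ‖) →
      eLpNorm (𝓕⁻ V) (ENNReal.ofReal q) volume ≤
        ENNReal.ofReal (C * K) * eLpNorm (𝓕⁻ G) (ENNReal.ofReal p) volume := by
  obtain ⟨C₁, hC₁, h₁⟩ := exists_eLpNorm_fourierInv_le (E := E) hq
  obtain ⟨C₂, hC₂, h₂⟩ := exists_eLpNorm_normWeight_neg_le (E := E) hp1 hp2
  refine ⟨C₁ * C₂, by positivity, fun G V K hK hG hG2 hV hVG => ?_⟩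
  set d := (Module.finrank ℝ E : ℝ) with hdd
  have h3 : eLpNorm (normWeight (d / 2 - d / q) V) 2 volume ≤
      ENNReal.ofReal K * eLpNorm (normWeight (-(d / p - d / 2)) G) 2 volume := by
    refine eLpNorm_le_mul_eLpNorm_of_ae_le_mul ?_ 2
    filter_upwards [ae_ne_zero] with ξ hξ
    rw [norm_normWeight, norm_normWeight]
    calc _ ≤ ‖ξ‖ ^ (d / 2 - d / q) * (K * ‖ξ‖ ^ (-(d / p - d / q)) * ‖G ξ‖) := by
          gcongr
          exact hVG ξ hξ
      _ = K * (‖ξ‖ ^ (d / 2 - d / q) * ‖ξ‖ ^ (-(d / p - d / q)) * ‖G ξ‖) := by ring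
      _ = _ := by
          rw [← Real.rpow_add (norm_pos_iff.2 hξ)]
          congr 3
          ring
  calc _ ≤ _ := h₁ V hV
    _ ≤ ENNReal.ofReal C₁ * (ENNReal.ofReal K * (ENNReal.ofReal C₂ * _)) := by
        gcongr
        exact h3.trans (by gcongr; exact h₂ G hG hG2)
    _ = _ := by
        rw [← mul_assoc, ← mul_assoc, ← ENNReal.ofReal_mul hC₁.le,
          ← ENNReal.ofReal_mul (by positivity)]
        congr 2
        ring

theorem eLpNorm_top_fourierInv_le (V : E → ℂ) :
    eLpNorm (𝓕⁻ V) ∞ volume ≤ ENNReal.ofReal (∫ ξ, ‖V ξ‖) := by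
  rw [eLpNorm_exponent_top]
  refine eLpNormEssSup_le_of_ae_bound (.of_forall fun x => ?_)
  exact norm_fourierInv_le_integral_norm V x

/-- With `g = 𝓕⁻ G`, inversion gives `sup |G| ≤ ‖g‖₁`, and so `‖𝓕⁻ V‖_∞ ≤ ‖V‖₁ ≤ (∫ k) ‖g‖₁`. If `g`
is not integrable the right side is infinite, which uses `∫ k > 0`. -/
theorem eLpNorm_top_fourierInv_le_of_norm_le {G V : E → ℂ} {k : E → ℝ} (hG : Integrable G)
    (hGc : Continuous G) (hk : Integrable k) (hk0 : ∀ ξ, 0 ≤ k ξ) (hkpos : 0 < ∫ ξ, k ξ)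
    (hVG : ∀ᵐ ξ, ‖V ξ‖ ≤ k ξ * ‖G ξ‖) :
    eLpNorm (𝓕⁻ V) ∞ volume ≤ ENNReal.ofReal (∫ ξ, k ξ) * eLpNorm (𝓕⁻ G) 1 volume := by
  by_cases hg : Integrable (𝓕⁻ G)
  swap
  · have : eLpNorm (𝓕⁻ G) 1 volume = ∞ := by
      by_contra h
      exact hg (memLp_one_iff_integrable.1
        ⟨(continuous_fourierInv hG).aestronglyMeasurable, lt_top_iff_ne_top.2 h⟩)
    rw [this, ENNReal.mul_top (by simpa using hkpos)]
    exact le_top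
  have hgF : Integrable (𝓕 G) := by
    have := hg.comp_neg
    simpa [Real.fourierInv_eq_fourier_neg] using this
  have hinv : 𝓕 (𝓕⁻ G) = G := hGc.fourier_fourierInv_eq hG hgF
  have hb : ∀ ξ, ‖G ξ‖ ≤ ∫ x, ‖𝓕⁻ G x‖ := fun ξ => by
    have := norm_fourier_le_integral_norm (𝓕⁻ G) ξ
    rwa [hinv] at this
  refine (eLpNorm_top_fourierInv_le V).trans ?_
  rw [eLpNorm_one_eq_lintegral_enorm, ← ofReal_integral_norm_eq_lintegral_enorm hg,
    ← ENNReal.ofReal_mul hkpos.le, ← integral_mul_const]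
  refine ENNReal.ofReal_le_ofReal (integral_mono_of_nonneg (.of_forall fun ξ => norm_nonneg _)
    (hk.mul_const _) ?_)
  filter_upwards [hVG] with ξ hξ
  refine hξ.trans ?_
  gcongr
  · exact hk0 ξ
  · exact hb ξ

end DualSobolev

/-! ### The integrable kernel for the endpoint `(1, ∞)` -/

section RadialKernel

variable {E : Type*} [NormedAddCommGroup E] [NormedSpace ℝ E] [FiniteDimensional ℝ E]
  [MeasurableSpace E] [BorelSpace E] (μ : Measure E) [μ.IsAddHaarMeasure]

/-- `γ < n` controls the origin and `σ + γ > n` controls infinity. -/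
theorem integrable_norm_rpow_neg_div_one_add [Nontrivial E] {γ σ : ℝ} (hγ0 : 0 ≤ γ)
    (hγ : γ < Module.finrank ℝ E) (hσ : Module.finrank ℝ E < σ + γ) :
    Integrable (fun ξ : E => ‖ξ‖ ^ (-γ) / (1 + ‖ξ‖ ^ σ)) μ := by
  have hm : AEStronglyMeasurable (fun ξ : E => ‖ξ‖ ^ (-γ) / (1 + ‖ξ‖ ^ σ)) μ := by
    refine Measurable.aestronglyMeasurable ?_
    fun_prop
  rw [← integrableOn_univ, ← Set.union_compl_self (Metric.ball (0 : E) 1)]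
  refine IntegrableOn.union ?_ ?_
  · refine (integrableOn_ball_norm_rpow_neg μ hγ 1).mono' hm.restrict (.of_forall fun ξ => ?_)
    rw [Real.norm_of_nonneg (by positivity)]
    exact div_le_self (by positivity) (le_add_of_nonneg_right (by positivity))
  · refine ((integrable_one_add_norm (μ := μ) hσ).const_mul (2 ^ (σ + γ))).integrableOn.mono'
      hm.restrict ?_
    filter_upwards [ae_restrict_mem Metric.isOpen_ball.measurableSet.compl] with ξ hξ
    have hξ1 : 1 ≤ ‖ξ‖ := by simpa using hξ
    have hξ0 : 0 < ‖ξ‖ := by linarith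
    rw [Real.norm_of_nonneg (by positivity)]
    calc ‖ξ‖ ^ (-γ) / (1 + ‖ξ‖ ^ σ) ≤ ‖ξ‖ ^ (-γ) / ‖ξ‖ ^ σ := by
          gcongr
          linarith
      _ = ‖ξ‖ ^ (-(σ + γ)) := by
          rw [← Real.rpow_sub hξ0]
          congr 1
          ring
      _ = 2 ^ (σ + γ) * (2 * ‖ξ‖) ^ (-(σ + γ)) := by
          rw [Real.mul_rpow (by norm_num) hξ0.le, ← mul_assoc, ← Real.rpow_add (by norm_num)]
          simp
      _ ≤ 2 ^ (σ + γ) * (1 + ‖ξ‖) ^ (-(σ + γ)) := by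
          gcongr ?_ * ?_
          exact Real.rpow_le_rpow_of_nonpos (by positivity) (by linarith) (by linarith)

/-- Since `T |ξ|^σ = |T^{1/σ} ξ|^σ`, the parameter acts by dilation; this is the source of the power
of `t` at the endpoint. -/
theorem norm_rpow_neg_div_one_add_mul_eq {γ σ T : ℝ} (hσ0 : 0 < σ) (hT : 0 < T) (ξ : E) :
    ‖ξ‖ ^ (-γ) / (1 + T * ‖ξ‖ ^ σ) = (T ^ (1 / σ)) ^ γ *
      (‖T ^ (1 / σ) • ξ‖ ^ (-γ) / (1 + ‖T ^ (1 / σ) • ξ‖ ^ σ)) := by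
  have hρ : 0 < T ^ (1 / σ) := by positivity
  have h1 : (T ^ (1 / σ)) ^ σ = T := by
    rw [← Real.rpow_mul hT.le, one_div_mul_cancel hσ0.ne', Real.rpow_one]
  rw [norm_smul, Real.norm_of_nonneg hρ.le, Real.mul_rpow hρ.le (norm_nonneg _),
    Real.mul_rpow hρ.le (norm_nonneg _), h1, ← mul_div_assoc, ← mul_assoc,
    ← Real.rpow_add hρ, add_neg_cancel, Real.rpow_zero, one_mul]

theorem integrable_norm_rpow_neg_div_one_add_mul [Nontrivial E] {γ σ T : ℝ} (hγ0 : 0 ≤ γ)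
    (hγ : γ < Module.finrank ℝ E) (hσ0 : 0 < σ) (hσ : Module.finrank ℝ E < σ + γ) (hT : 0 < T) :
    Integrable (fun ξ : E => ‖ξ‖ ^ (-γ) / (1 + T * ‖ξ‖ ^ σ)) μ := by
  simp only [norm_rpow_neg_div_one_add_mul_eq hσ0 hT]
  exact ((integrable_norm_rpow_neg_div_one_add μ hγ0 hγ hσ).comp_smul
    (show T ^ (1 / σ) ≠ 0 by positivity)).const_mul _

theorem integral_norm_rpow_neg_div_one_add_mul {γ σ T : ℝ} (hσ0 : 0 < σ) (hT : 0 < T) :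
    ∫ ξ : E, ‖ξ‖ ^ (-γ) / (1 + T * ‖ξ‖ ^ σ) ∂μ =
      T ^ (-(Module.finrank ℝ E - γ) / σ) * ∫ ξ : E, ‖ξ‖ ^ (-γ) / (1 + ‖ξ‖ ^ σ) ∂μ := by
  have hρ : 0 < T ^ (1 / σ) := by positivity
  simp only [norm_rpow_neg_div_one_add_mul_eq hσ0 hT]
  rw [integral_const_mul, Measure.integral_comp_smul_of_nonneg μ
    (fun ξ : E => ‖ξ‖ ^ (-γ) / (1 + ‖ξ‖ ^ σ)) _ (hR := hρ.le), smul_eq_mul, ← mul_assoc]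
  congr 1
  rw [← Real.rpow_natCast, ← Real.rpow_neg hρ.le, ← Real.rpow_add hρ, ← Real.rpow_mul hT.le]
  congr 1
  ring

theorem integral_norm_rpow_neg_div_one_add_pos [Nontrivial E] {γ σ : ℝ} (hγ0 : 0 ≤ γ)
    (hγ : γ < Module.finrank ℝ E) (hσ : Module.finrank ℝ E < σ + γ) :
    0 < ∫ ξ : E, ‖ξ‖ ^ (-γ) / (1 + ‖ξ‖ ^ σ) ∂μ := by
  rw [integral_pos_iff_support_of_nonneg (fun ξ => by positivity)
    (integrable_norm_rpow_neg_div_one_add μ hγ0 hγ hσ)]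
  have hsub : ({0}ᶜ : Set E) ⊆ Function.support fun ξ : E => ‖ξ‖ ^ (-γ) / (1 + ‖ξ‖ ^ σ) := by
    intro ξ hξ
    have : 0 < ‖ξ‖ := norm_pos_iff.2 hξ
    exact ne_of_gt (by positivity)
  refine lt_of_lt_of_le ?_ (measure_mono hsub)
  exact isOpen_compl_singleton.measure_pos μ (Set.nonempty_compl_of_nontrivial 0)

end RadialKernel

/-! ### The operators as Fourier multipliers and their symbols -/

section Operators

variable {n : ℕ}

theorem angularFourier_two_pi_smul (φ : 𝓢(EuclideanSpace ℝ (Fin n), ℂ))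
    (ξ : EuclideanSpace ℝ (Fin n)) :
    angularFourier φ ((2 * Real.pi) • ξ) = 𝓕 φ ξ := by
  rw [SchwartzMap.fourier_coe, Real.fourier_eq', angularFourier]
  refine integral_congr_ae (.of_forall fun x => ?_)
  simp only [smul_eq_mul]
  rw [mul_comm, real_inner_smul_right]
  congr 2
  push_cast
  ring

theorem norm_two_pi_smul (ξ : EuclideanSpace ℝ (Fin n)) :
    ‖(2 * Real.pi) • ξ‖ = 2 * Real.pi * ‖ξ‖ := by
  rw [norm_smul, Real.norm_of_nonneg Real.two_pi_pos.le]

/-- Passing from the angular normalisation of the inverse Fourier integral to that of `𝓕⁻`. -/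
theorem inv_two_pi_pow_mul_integral (m : EuclideanSpace ℝ (Fin n) → ℂ)
    (x : EuclideanSpace ℝ (Fin n)) :
    (((2 * Real.pi) ^ n : ℝ) : ℂ)⁻¹ *
      ∫ ξ, m ξ * Complex.exp (Complex.I * ((inner ℝ x ξ : ℝ) : ℂ)) =
      𝓕⁻ (fun ξ => m ((2 * Real.pi) • ξ)) x := by
  have h := Measure.integral_comp_smul_of_nonneg (volume : Measure (EuclideanSpace ℝ (Fin n)))
    (fun ξ => m ξ * Complex.exp (Complex.I * ((inner ℝ x ξ : ℝ) : ℂ))) (2 * Real.pi)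
    (hR := Real.two_pi_pos.le)
  rw [finrank_euclideanSpace_fin, Complex.real_smul, Complex.ofReal_inv] at h
  rw [← h, Real.fourierInv_eq']
  refine integral_congr_ae (.of_forall fun ξ => ?_)
  simp only [smul_eq_mul]
  rw [mul_comm, real_inner_smul_right, real_inner_comm]
  congr 2
  push_cast
  ring

/-- The Fourier transform (with Mathlib's normalisation) of `mlOperator η α β lam σ t φ`. -/
noncomputable def mlSymbol (η α β : ℝ) (lam : ℂ) (σ t : ℝ) (φ : 𝓢(EuclideanSpace ℝ (Fin n), ℂ))
    (ξ : EuclideanSpace ℝ (Fin n)) : ℂ :=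
  (((2 * Real.pi * ‖ξ‖) ^ η : ℝ) : ℂ) *
    mittagLeffler α β (-lam * (((2 * Real.pi * ‖ξ‖) ^ σ * t ^ α : ℝ) : ℂ)) * 𝓕 φ ξ

theorem mlOperator_eq (η α β : ℝ) (lam : ℂ) (σ t : ℝ) (φ : 𝓢(EuclideanSpace ℝ (Fin n), ℂ)) :
    mlOperator η α β lam σ t φ = 𝓕⁻ (mlSymbol η α β lam σ t φ) := by
  ext x
  rw [mlOperator]
  simp only [mlIntegrand]
  rw [inv_two_pi_pow_mul_integral]
  simp only [norm_two_pi_smul, angularFourier_two_pi_smul]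
  rfl

theorem fracLaplacian_eq (γ : ℝ) (φ : 𝓢(EuclideanSpace ℝ (Fin n), ℂ)) :
    fracLaplacian γ φ = 𝓕⁻ (fun ξ => (((2 * Real.pi * ‖ξ‖) ^ γ : ℝ) : ℂ) * 𝓕 φ ξ) := by
  ext x
  rw [fracLaplacian, inv_two_pi_pow_mul_integral]
  simp only [norm_two_pi_smul, angularFourier_two_pi_smul]

theorem fracLaplacian_zero (φ : 𝓢(EuclideanSpace ℝ (Fin n), ℂ)) : fracLaplacian 0 φ = φ := by
  rw [fracLaplacian_eq]
  simp only [Real.rpow_zero, Complex.ofReal_one, one_mul]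
  rw [← SchwartzMap.fourierInv_coe (𝓕 φ), FourierTransform.fourierInv_fourier_eq]

theorem integrable_mlIntegrand {η α β : ℝ} {lam : ℂ} {σ t : ℝ}
    {φ : 𝓢(EuclideanSpace ℝ (Fin n), ℂ)} (h : Integrable (mlSymbol η α β lam σ t φ))
    (x : EuclideanSpace ℝ (Fin n)) : Integrable (mlIntegrand η α β lam σ t φ x) := by
  rw [← integrable_comp_smul_iff volume (mlIntegrand η α β lam σ t φ x) Real.two_pi_pos.ne']
  have he : Continuous fun ξ : EuclideanSpace ℝ (Fin n) =>
      Complex.exp (Complex.I * ((inner ℝ x ((2 * Real.pi) • ξ) : ℝ) : ℂ)) := by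
    fun_prop
  refine (h.mul_bdd (c := 1) he.aestronglyMeasurable (.of_forall fun ξ => ?_)).congr
    (.of_forall fun ξ => ?_)
  · rw [mul_comm, Complex.norm_exp_ofReal_mul_I]
  · simp only [mlIntegrand, mlSymbol, norm_two_pi_smul, angularFourier_two_pi_smul]

theorem memLp_rpow_mul_schwartz {s : ℝ} (hs : 0 ≤ s) (ψ : 𝓢(EuclideanSpace ℝ (Fin n), ℂ))
    (r : ℝ≥0∞) :
    MemLp (fun ξ => (((2 * Real.pi * ‖ξ‖) ^ s : ℝ) : ℂ) * ψ ξ) r := by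
  have hg := Function.hasTemperateGrowth_one_add_norm_sq_rpow (EuclideanSpace ℝ (Fin n)) (s / 2)
  set Ψ := SchwartzMap.smulLeftCLM ℂ (fun x : EuclideanSpace ℝ (Fin n) =>
    (1 + ‖x‖ ^ 2) ^ (s / 2)) ψ with hΨ
  refine ((Ψ.memLp r volume).const_mul (((2 * Real.pi) ^ s : ℝ) : ℂ)).of_le ?_
    (.of_forall fun ξ => ?_)
  · refine Measurable.aestronglyMeasurable ?_
    exact (by fun_prop : Measurable fun ξ : EuclideanSpace ℝ (Fin n) =>
      (((2 * Real.pi * ‖ξ‖) ^ s : ℝ) : ℂ)).mul ψ.continuous.measurable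
  · have hπ := Real.two_pi_pos
    rw [hΨ, SchwartzMap.smulLeftCLM_apply_apply hg, norm_mul, norm_mul, norm_smul,
      Complex.norm_real, Complex.norm_real, Real.norm_of_nonneg (by positivity),
      Real.norm_of_nonneg (by positivity), Real.norm_of_nonneg (by positivity),
      Real.mul_rpow hπ.le (norm_nonneg _), mul_assoc]
    gcongr
    calc ‖ξ‖ ^ s = (‖ξ‖ ^ 2) ^ (s / 2) := by
          rw [← Real.rpow_natCast, ← Real.rpow_mul (norm_nonneg _)]
          congr 1
          push_cast
          ring
      _ ≤ _ := by gcongr; linarith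

theorem measurable_mlSymbol (η : ℝ) {α : ℝ} (hα : 0 < α) (β : ℝ) (lam : ℂ) (σ t : ℝ)
    (φ : 𝓢(EuclideanSpace ℝ (Fin n), ℂ)) : Measurable (mlSymbol η α β lam σ t φ) := by
  have h1 : Measurable (mittagLeffler α β) :=
    (hasSum_deriv_mittagLeffler β hα 0).1.continuous.measurable
  unfold mlSymbol
  refine ((by fun_prop : Measurable fun ξ : EuclideanSpace ℝ (Fin n) =>
    (((2 * Real.pi * ‖ξ‖) ^ η : ℝ) : ℂ)).mul ?_).mul (𝓕 φ).continuous.measurable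
  exact h1.comp (by fun_prop)

/-- The bound on Fourier multipliers that drives all the estimates. -/
def MultiplierBound (σ t α K : ℝ) (φ : 𝓢(EuclideanSpace ℝ (Fin n), ℂ))
    (V : EuclideanSpace ℝ (Fin n) → ℂ) : Prop :=
  ∀ ξ, ‖V ξ‖ ≤ K / (1 + t ^ α * (2 * Real.pi * ‖ξ‖) ^ σ) * ‖𝓕 φ ξ‖

theorem MultiplierBound.norm_le {σ t α K : ℝ} {φ : 𝓢(EuclideanSpace ℝ (Fin n), ℂ)}
    {V : EuclideanSpace ℝ (Fin n) → ℂ} (hK : 0 ≤ K) (ht : 0 < t)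
    (h : MultiplierBound σ t α K φ V) (ξ : EuclideanSpace ℝ (Fin n)) :
    ‖V ξ‖ ≤ K * ‖𝓕 φ ξ‖ := by
  have hπ := Real.pi_pos
  refine (h ξ).trans ?_
  gcongr
  exact div_le_self hK (le_add_of_nonneg_right (by positivity))

theorem exists_multiplierBound_mlSymbol {α : ℝ} (β : ℝ) (hα0 : 0 < α) (hα1 : α ≤ 1) {lam : ℂ}
    (hlam : AdmissibleLambda α lam) (n : ℕ) (σ : ℝ) :
    ∃ C > 0, ∀ t : ℝ, 0 < t → ∀ φ : 𝓢(EuclideanSpace ℝ (Fin n), ℂ),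
      MultiplierBound σ t α C φ (mlSymbol 0 α β lam σ t φ) := by
  obtain ⟨C, hC, h⟩ := exists_norm_mittagLeffler_le β hα0 hα1 hlam
  refine ⟨C, hC, fun t ht φ ξ => ?_⟩
  have hπ := Real.pi_pos
  rw [mlSymbol, Real.rpow_zero, Complex.ofReal_one, one_mul, norm_mul]
  gcongr
  rw [mul_comm (t ^ α)]
  exact h _ (by positivity)

/-- With `r = t^α (2π|ξ|)^σ`, the factor `(2π|ξ|)^σ` equals `t^{-α} r`, and the decay of `r
E_{α,α}(-lam r)` absorbs the `r`. -/
theorem exists_multiplierBound_mlSymbol_self {α : ℝ} (hα0 : 0 < α) (hα1 : α ≤ 1) {lam : ℂ}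
    (hlam : AdmissibleLambda α lam) (n : ℕ) (σ : ℝ) :
    ∃ C > 0, ∀ t : ℝ, 0 < t → ∀ φ : 𝓢(EuclideanSpace ℝ (Fin n), ℂ),
      MultiplierBound σ t α (C * t ^ (-α)) φ (mlSymbol σ α α lam σ t φ) := by
  obtain ⟨C, hC, h⟩ := exists_mul_norm_mittagLeffler_self_le hα0 hα1 hlam
  refine ⟨C, hC, fun t ht φ ξ => ?_⟩
  have hπ := Real.pi_pos
  rw [mlSymbol, norm_mul, norm_mul, Complex.norm_real, Real.norm_of_nonneg (by positivity)]
  gcongr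
  rw [mul_comm (t ^ α)]
  have h1 := h ((2 * Real.pi * ‖ξ‖) ^ σ * t ^ α) (by positivity)
  have h2 : t ^ (-α) * t ^ α = 1 := by rw [← Real.rpow_add ht]; simp
  calc (2 * Real.pi * ‖ξ‖) ^ σ * ‖mittagLeffler α α (-lam * ((((2 * Real.pi * ‖ξ‖) ^ σ * t ^ α : ℝ) : ℂ)))‖
      = t ^ (-α) * ((2 * Real.pi * ‖ξ‖) ^ σ * t ^ α *
          ‖mittagLeffler α α (-lam * ((((2 * Real.pi * ‖ξ‖) ^ σ * t ^ α : ℝ) : ℂ)))‖) := by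
        linear_combination (-(2 * Real.pi * ‖ξ‖) ^ σ *
          ‖mittagLeffler α α (-lam * ((((2 * Real.pi * ‖ξ‖) ^ σ * t ^ α : ℝ) : ℂ)))‖) * h2
    _ ≤ t ^ (-α) * (C / (1 + (2 * Real.pi * ‖ξ‖) ^ σ * t ^ α)) := by gcongr
    _ = _ := by ring

end Operators

/-! ### Membership in the homogeneous Sobolev space -/

section Distributions

variable {n : ℕ}

theorem exists_represents_of_integrable {v : EuclideanSpace ℝ (Fin n) → ℂ} (hv : Integrable v) :
    ∃ T : 𝓢'(EuclideanSpace ℝ (Fin n), ℂ), Represents T v := by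
  have hv1 : MemLp v 1 := memLp_one_iff_integrable.2 hv
  refine ⟨Lp.toTemperedDistribution (hv1.toLp v), fun ψ => ⟨?_, ?_⟩⟩
  · exact hv.bdd_mul ψ.continuous.aestronglyMeasurable
      (.of_forall ψ.toBoundedContinuousFunction.norm_coe_le_norm)
  · rw [Lp.toTemperedDistribution_apply]
    refine integral_congr_ae ?_
    filter_upwards [hv1.coeFn_toLp] with x hx
    rw [hx, smul_eq_mul]

theorem Represents.fourierInv {T : 𝓢'(EuclideanSpace ℝ (Fin n), ℂ)}
    {v : EuclideanSpace ℝ (Fin n) → ℂ} (hv : Integrable v) (h : Represents T v) :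
    Represents (𝓕⁻ T) (𝓕⁻ v) := by
  refine fun ψ => ⟨?_, ?_⟩
  · exact ψ.integrable.mul_bdd (continuous_fourierInv hv).aestronglyMeasurable
      (.of_forall (norm_fourierInv_le_integral_norm v))
  · rw [TemperedDistribution.fourierInv_apply, (h _).2, ← integral_fourierInv_mul_eq ψ.integrable hv,
      SchwartzMap.fourierInv_coe]

/-- As `v` and `|ξ|^s v` are both integrable, each is a tempered distribution, and their inverse
transforms serve as `T` and `G`. -/
theorem memHomSobolev_fourierInv {s : ℝ} {q : ℝ≥0∞} {v w : EuclideanSpace ℝ (Fin n) → ℂ}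
    (hv : Integrable v) (hw : Integrable w)
    (hvw : ∀ ξ, w ξ = (((2 * Real.pi * ‖ξ‖) ^ s : ℝ) : ℂ) * v ξ) (hwq : MemLp (𝓕⁻ w) q) :
    MemHomSobolev s q (𝓕⁻ v) := by
  obtain ⟨T, hT⟩ := exists_represents_of_integrable hv
  obtain ⟨G, hG⟩ := exists_represents_of_integrable hw
  refine ⟨𝓕⁻ T, 𝓕⁻ G, 𝓕⁻ w, hT.fourierInv hv, ⟨v, ?_, ?_⟩, hG.fourierInv hw, hwq⟩
  · rwa [FourierTransform.fourier_fourierInv_eq]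
  · rw [FourierTransform.fourier_fourierInv_eq, ← funext hvw]
    exact hG

end Distributions

/-! ### Reduction of the exponent regions to one common condition -/

section Exponents

/-- The exponents for which the multiplier estimate is a consequence of Sobolev embeddings, or
`(p, q) = (1, ∞)`. -/
def EstimateCase (n : ℕ) (σ γ : ℝ) (p q : ℝ≥0∞) : Prop :=
  0 < σ ∧ 0 ≤ γ ∧ ((γ < n ∧ (n : ℝ) < σ + γ ∧ p = 1 ∧ q = ∞) ∨
    ∃ p' q' : ℝ, p = ENNReal.ofReal p' ∧ q = ENNReal.ofReal q' ∧ 1 < p' ∧ p' < 2 ∧ 2 < q' ∧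
      γ ≤ n / p' - n / q' ∧ n / p' - n / q' ≤ σ + γ)

theorem dimDiv_ofReal (n : ℕ) {p : ℝ} (hp : 0 < p) : dimDiv n (ENNReal.ofReal p) = n / p := by
  rw [dimDiv, ENNReal.toReal_inv, ENNReal.toReal_ofReal hp.le, div_eq_mul_inv]

/-- From `0 < n/q ≤ n/p - n/2` one reads off `p < 2`, and with `n/p < n` also `n/q < n/2`, that is
`q > 2`; positivity of `n/q` excludes `q = ∞`. -/
theorem exists_ofReal_of_dimDiv {n : ℕ} (hn : 0 < n) {p q : ℝ≥0∞}
    (hp : dimDiv n p < n) (hq0 : 0 < dimDiv n q) (hq : dimDiv n q ≤ dimDiv n p - (n : ℝ) / 2) :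
    ∃ p' q' : ℝ, p = ENNReal.ofReal p' ∧ q = ENNReal.ofReal q' ∧ 1 < p' ∧ p' < 2 ∧ 2 < q' := by
  have hn0 : (0 : ℝ) < n := by exact_mod_cast hn
  have hne : ∀ r : ℝ≥0∞, 0 < dimDiv n r → 0 < r.toReal ∧ r = ENNReal.ofReal r.toReal := by
    intro r hr
    have hr1 : 0 < (r⁻¹).toReal := by
      rw [dimDiv] at hr
      exact (pos_iff_pos_of_mul_pos hr).1 hn0
    rw [ENNReal.toReal_inv, inv_pos] at hr1
    exact ⟨hr1, (ENNReal.ofReal_toReal fun h => by simp [h] at hr1).symm⟩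
  obtain ⟨hp0, hpr⟩ := hne p (by linarith [show (0 : ℝ) < n / 2 by positivity])
  obtain ⟨hq0', hqr⟩ := hne q hq0
  rw [hpr, dimDiv_ofReal n hp0] at hp hq
  rw [hqr, dimDiv_ofReal n hq0'] at hq hq0
  refine ⟨p.toReal, q.toReal, hpr, hqr, ?_, ?_, ?_⟩
  · rw [div_lt_iff₀ hp0] at hp
    nlinarith
  · have : (n : ℝ) / 2 < n / p.toReal := by linarith
    exact (div_lt_div_iff_of_pos_left hn0 (by norm_num) hp0).1 this
  · have : (n : ℝ) / q.toReal < n / 2 := by linarith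
    exact (div_lt_div_iff_of_pos_left hn0 hq0' (by norm_num)).1 this

theorem LebesgueCase.estimateCase {n : ℕ} (hn : 0 < n) {σ : ℝ} {p q : ℝ≥0∞}
    (h : LebesgueCase n σ p q) : EstimateCase n σ 0 p q := by
  have hn0 : (0 : ℝ) < n := by exact_mod_cast hn
  rcases h with ⟨h1, h2, h3⟩ | ⟨h1, -, -, h2, h3, h4, h5⟩
  · exact ⟨by linarith, le_rfl, Or.inl ⟨hn0, by linarith, h2, h3⟩⟩
  · rw [lt_min_iff] at h3
    rw [max_lt_iff] at h4
    obtain ⟨p', q', hp, hq, hp1, hp2, hq2⟩ := exists_ofReal_of_dimDiv hn h3.1 h4.1 h5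
    refine ⟨by linarith, le_rfl, Or.inr ⟨p', q', hp, hq, hp1, hp2, hq2, ?_⟩⟩
    rw [hp, hq, dimDiv_ofReal n (by linarith), dimDiv_ofReal n (by linarith)] at h4 h5
    have := min_le_right (n : ℝ) σ
    constructor <;> linarith [h4.2]

theorem SobolevCase.estimateCase {n : ℕ} (hn : 0 < n) {σ γ : ℝ} {p q : ℝ≥0∞}
    (h : SobolevCase n σ γ p q) : 0 < γ ∧ EstimateCase n σ γ p q := by
  have hn0 : (0 : ℝ) < n := by exact_mod_cast hn
  rcases h with ⟨h0, h1, h2, h3, h4⟩ | ⟨h0, h1, h2, -, -, h3, h4, h5, h6⟩ |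
    ⟨h0, h1, h2, -, -, h3, h4, h5, h6⟩
  · exact ⟨h0, by linarith, h0.le, Or.inl ⟨h1, by linarith, h3, h4⟩⟩
  · rw [lt_min_iff] at h4
    rw [max_lt_iff] at h5
    obtain ⟨p', q', hp, hq, hp1, hp2, hq2⟩ := exists_ofReal_of_dimDiv hn h4.1 h5.1 h6
    refine ⟨h0, by linarith, h0.le, Or.inr ⟨p', q', hp, hq, hp1, hp2, hq2, ?_⟩⟩
    rw [hp, hq, dimDiv_ofReal n (by linarith), dimDiv_ofReal n (by linarith)] at h5 h6
    have := min_le_right (n : ℝ) (σ + γ)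
    constructor <;> linarith [h5.2]
  · have hγ : 0 < γ := by linarith
    rw [lt_min_iff] at h4
    rw [max_lt_iff] at h5
    obtain ⟨p', q', hp, hq, hp1, hp2, hq2⟩ :=
      exists_ofReal_of_dimDiv hn h4.1 h5.1 (by linarith)
    refine ⟨hγ, h0, hγ.le, Or.inr ⟨p', q', hp, hq, hp1, hp2, hq2, ?_⟩⟩
    rw [hp, hq, dimDiv_ofReal n (by linarith), dimDiv_ofReal n (by linarith)] at h5 h6
    have := min_le_right (n : ℝ) (σ + γ)
    constructor <;> linarith [h5.2]

end Exponents

/-! ### The estimates -/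

section Estimates

variable {n : ℕ}

/-- With `y = t^α x^σ` and `e = (a - γ)/σ ∈ [0, 1]`, this is `y^e ≤ 1 + y`. The constraints `γ ≤ a ≤
σ + γ` say exactly that `e ∈ [0, 1]`. -/
theorem rpow_neg_div_one_add_le {α σ γ a t x : ℝ} (hσ : 0 < σ) (hγ : γ ≤ a) (ha : a ≤ σ + γ)
    (ht : 0 < t) (hx : 0 < x) :
    x ^ (-γ) / (1 + t ^ α * x ^ σ) ≤ t ^ (-(α / σ) * (a - γ)) * x ^ (-a) := by
  set y := t ^ α * x ^ σ with hy
  have hy0 : 0 < y := by positivity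
  have h1 : y ^ ((a - γ) / σ) ≤ 1 + y := by
    have he0 : 0 ≤ (a - γ) / σ := div_nonneg (by linarith) hσ.le
    have he1 : (a - γ) / σ ≤ 1 := by rw [div_le_one hσ]; linarith
    rcases le_total y 1 with h | h
    · linarith [Real.rpow_le_one hy0.le h he0]
    · have := Real.rpow_le_rpow_of_exponent_le h he1
      rw [Real.rpow_one] at this
      linarith
  have h2 : y ^ ((a - γ) / σ) = t ^ ((α / σ) * (a - γ)) * x ^ (a - γ) := by
    rw [hy, Real.mul_rpow (by positivity) (by positivity), ← Real.rpow_mul ht.le,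
      ← Real.rpow_mul hx.le]
    congr 2 <;> field_simp
  rw [div_le_iff₀ (by positivity)]
  calc x ^ (-γ) = t ^ (-(α / σ) * (a - γ)) * x ^ (-a) * y ^ ((a - γ) / σ) := by
        rw [h2, mul_mul_mul_comm, ← Real.rpow_add ht, ← Real.rpow_add hx]
        rw [show -(α / σ) * (a - γ) + α / σ * (a - γ) = 0 by ring, Real.rpow_zero, one_mul]
        congr 1
        ring
    _ ≤ _ := by gcongr

theorem continuous_rpow_mul_fourier {γ : ℝ} (hγ : 0 ≤ γ) (φ : 𝓢(EuclideanSpace ℝ (Fin n), ℂ)) :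
    Continuous fun ξ => (((2 * Real.pi * ‖ξ‖) ^ γ : ℝ) : ℂ) * 𝓕 φ ξ := by
  refine Continuous.mul ?_ (𝓕 φ).continuous
  refine Complex.continuous_ofReal.comp (Continuous.rpow_const (by fun_prop) fun ξ => Or.inr hγ)

theorem integrable_of_multiplierBound {σ t α K : ℝ} (hK : 0 ≤ K) (ht : 0 < t)
    {φ : 𝓢(EuclideanSpace ℝ (Fin n), ℂ)} {V : EuclideanSpace ℝ (Fin n) → ℂ}
    (hVm : Measurable V) (hV : MultiplierBound σ t α K φ V) : Integrable V := by
  refine ((𝓕 φ).integrable.norm.const_mul K).mono' hVm.aestronglyMeasurable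
    (.of_forall (hV.norm_le hK ht))

/-- Finiteness is taken from the Schwartz decay of `𝓕 φ`, not from the quantitative estimate, whose
right side is not known here to be finite. -/
theorem memLp_fourierInv_of_multiplierBound (hn : 0 < n) {σ γ t α K : ℝ} {p q : ℝ≥0∞}
    (hc : EstimateCase n σ γ p q) (hK : 0 ≤ K) (ht : 0 < t)
    {φ : 𝓢(EuclideanSpace ℝ (Fin n), ℂ)} {V : EuclideanSpace ℝ (Fin n) → ℂ}
    (hVm : Measurable V) (hV : MultiplierBound σ t α K φ V) : MemLp (𝓕⁻ V) q := by
  have hVi := integrable_of_multiplierBound hK ht hVm hV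
  refine ⟨(continuous_fourierInv hVi).aestronglyMeasurable, ?_⟩
  obtain ⟨-, -, ⟨-, -, -, rfl⟩ | ⟨p', q', -, rfl, -, -, hq2, -⟩⟩ := hc
  · exact (eLpNorm_top_fourierInv_le V).trans_lt ENNReal.ofReal_lt_top
  · have : Nontrivial (EuclideanSpace ℝ (Fin n)) :=
      Module.nontrivial_of_finrank_pos (R := ℝ) (by simpa using hn)
    obtain ⟨C, hC, h⟩ := exists_eLpNorm_fourierInv_le (E := EuclideanSpace ℝ (Fin n)) hq2
    refine (h V hVi).trans_lt (ENNReal.mul_lt_top ENNReal.ofReal_lt_top ?_)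
    rw [finrank_euclideanSpace_fin]
    set s := (n : ℝ) / 2 - n / q' with hs
    have hs0 : 0 ≤ s := by
      rw [hs, sub_nonneg]
      gcongr
    have hπ := Real.two_pi_pos
    have hm := (memLp_rpow_mul_schwartz hs0 (𝓕 φ) 2).const_mul (((K * ((2 * Real.pi) ^ s)⁻¹ : ℝ)) : ℂ)
    refine (hm.of_le (aestronglyMeasurable_normWeight s hVi.1) (.of_forall fun ξ => ?_)).2
    rw [norm_normWeight, norm_mul, norm_mul, Complex.norm_real, Complex.norm_real,
      Real.norm_of_nonneg (by positivity), Real.norm_of_nonneg (by positivity),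
      Real.mul_rpow hπ.le (norm_nonneg _)]
    calc _ ≤ ‖ξ‖ ^ s * (K * ‖𝓕 φ ξ‖) := by
          gcongr
          exact hV.norm_le hK ht ξ
      _ = _ := by field_simp

theorem MultiplierBound.norm_le_mul_rpow {σ γ t α K : ℝ} {φ : 𝓢(EuclideanSpace ℝ (Fin n), ℂ)}
    {V : EuclideanSpace ℝ (Fin n) → ℂ} (hV : MultiplierBound σ t α K φ V)
    {ξ : EuclideanSpace ℝ (Fin n)} (hξ : ξ ≠ 0) :
    ‖V ξ‖ ≤ K * ((2 * Real.pi * ‖ξ‖) ^ (-γ) / (1 + t ^ α * (2 * Real.pi * ‖ξ‖) ^ σ)) *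
      ‖(((2 * Real.pi * ‖ξ‖) ^ γ : ℝ) : ℂ) * 𝓕 φ ξ‖ := by
  have hξ0 : 0 < 2 * Real.pi * ‖ξ‖ := mul_pos Real.two_pi_pos (norm_pos_iff.2 hξ)
  refine (hV ξ).trans_eq ?_
  rw [norm_mul, Complex.norm_real, Real.norm_of_nonneg (by positivity)]
  have : (2 * Real.pi * ‖ξ‖) ^ (-γ) * (2 * Real.pi * ‖ξ‖) ^ γ = 1 := by
    rw [← Real.rpow_add hξ0]; simp
  linear_combination (-(K / (1 + t ^ α * (2 * Real.pi * ‖ξ‖) ^ σ)) * ‖𝓕 φ ξ‖) * this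

theorem exists_eLpNorm_fourierInv_le_of_multiplierBound (hn : 0 < n) {σ γ : ℝ} {p q : ℝ≥0∞}
    (hc : EstimateCase n σ γ p q) (α : ℝ) :
    ∃ A > 0, ∀ (t K : ℝ), 0 < t → 0 < K → ∀ (φ : 𝓢(EuclideanSpace ℝ (Fin n), ℂ))
      (V : EuclideanSpace ℝ (Fin n) → ℂ), Measurable V → MultiplierBound σ t α K φ V →
      eLpNorm (𝓕⁻ V) q volume ≤
        ENNReal.ofReal (A * K * t ^ (-(α / σ) * (dimDiv n p - dimDiv n q - γ))) *
          eLpNorm (fracLaplacian γ φ) p volume := by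
  have : Nontrivial (EuclideanSpace ℝ (Fin n)) :=
    Module.nontrivial_of_finrank_pos (R := ℝ) (by simpa using hn)
  have hfr : (Module.finrank ℝ (EuclideanSpace ℝ (Fin n)) : ℝ) = n := by
    rw [finrank_euclideanSpace_fin]
  have hπ := Real.two_pi_pos
  obtain ⟨hσ, hγ0, ⟨hγn, hσγ, rfl, rfl⟩ | ⟨p', q', rfl, rfl, hp1, hp2, hq2, ha, ha'⟩⟩ := hc
  · have hγn' := hfr ▸ hγn
    have hσγ' := hfr ▸ hσγ
    set J := ∫ ξ : EuclideanSpace ℝ (Fin n), ‖ξ‖ ^ (-γ) / (1 + ‖ξ‖ ^ σ) with hJ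
    have hJ0 : 0 < J := integral_norm_rpow_neg_div_one_add_pos volume hγ0 hγn' hσγ'
    refine ⟨(2 * Real.pi) ^ (-γ) * ((2 * Real.pi) ^ σ) ^ (-(n - γ) / σ) * J, by positivity,
      fun t K ht hK φ V hVm hV => ?_⟩
    -- The factor `(2π)^σ` from the normalisation of `𝓕` is absorbed into the dilation parameter.
    set T := t ^ α * (2 * Real.pi) ^ σ with hT
    have hT0 : 0 < T := by positivity
    set k : EuclideanSpace ℝ (Fin n) → ℝ := fun ξ =>
      K * (2 * Real.pi) ^ (-γ) * (‖ξ‖ ^ (-γ) / (1 + T * ‖ξ‖ ^ σ)) with hk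
    have hki : Integrable k :=
      (integrable_norm_rpow_neg_div_one_add_mul volume hγ0 hγn' hσ hσγ' hT0).const_mul _
    have hkint : ∫ ξ, k ξ = (2 * Real.pi) ^ (-γ) * ((2 * Real.pi) ^ σ) ^ (-(n - γ) / σ) * J * K *
        t ^ (-(α / σ) * (n - γ)) := by
      rw [hk, integral_const_mul, integral_norm_rpow_neg_div_one_add_mul volume hσ hT0, hfr, hT,
        Real.mul_rpow (x := t ^ α) (by positivity) (by positivity), ← Real.rpow_mul ht.le, ← hJ,
        show α * (-(n - γ) / σ) = -(α / σ) * (n - γ) by ring]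
      ring
    have h := eLpNorm_top_fourierInv_le_of_norm_le (V := V) (k := k)
      (memLp_one_iff_integrable.1 (memLp_rpow_mul_schwartz hγ0 (𝓕 φ) 1))
      (continuous_rpow_mul_fourier hγ0 φ) hki (fun ξ => by positivity)
      (by rw [hkint]; positivity) ?_
    · rw [← fracLaplacian_eq, hkint] at h
      convert h using 4
      simp [dimDiv]
    · filter_upwards [ae_ne_zero] with ξ hξ
      refine (hV.norm_le_mul_rpow (γ := γ) hξ).trans_eq ?_
      congr 1
      rw [hk, hT, Real.mul_rpow hπ.le (norm_nonneg _), Real.mul_rpow hπ.le (norm_nonneg _)]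
      ring
  · rw [dimDiv_ofReal n (by linarith), dimDiv_ofReal n (by linarith)]
    obtain ⟨C, hC, h⟩ := exists_eLpNorm_fourierInv_le_of_norm_le (E := EuclideanSpace ℝ (Fin n))
      hp1 hp2 hq2
    rw [hfr] at h
    set a := (n : ℝ) / p' - n / q' with had
    refine ⟨C * (2 * Real.pi) ^ (-a), by positivity, fun t K ht hK φ V hVm hV => ?_⟩
    have h' := h _ V (K * (2 * Real.pi) ^ (-a) * t ^ (-(α / σ) * (a - γ))) (by positivity)
      (memLp_one_iff_integrable.1 (memLp_rpow_mul_schwartz hγ0 (𝓕 φ) 1))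
      (memLp_rpow_mul_schwartz hγ0 (𝓕 φ) 2) (integrable_of_multiplierBound hK.le ht hVm hV) ?_
    · rw [← fracLaplacian_eq] at h'
      convert h' using 3
      ring
    · intro ξ hξ
      refine (hV.norm_le_mul_rpow (γ := γ) hξ).trans ?_
      gcongr ?_ * _
      have hb := rpow_neg_div_one_add_le (α := α) hσ ha ha' ht
        (mul_pos hπ (norm_pos_iff.2 hξ))
      rw [Real.mul_rpow (y := ‖ξ‖) (z := -a) hπ.le (norm_nonneg _)] at hb
      calc _ ≤ K * (t ^ (-(α / σ) * (a - γ)) * ((2 * Real.pi) ^ (-a) * ‖ξ‖ ^ (-a))) := by gcongr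
        _ = _ := by ring

theorem mlOperator_estimates (hn : 0 < n) {α : ℝ} (β : ℝ) (hα0 : 0 < α) (hα1 : α ≤ 1)
    {lam : ℂ} (hlam : AdmissibleLambda α lam) {σ γ : ℝ} {p q : ℝ≥0∞}
    (hc : EstimateCase n σ γ p q) :
    ∃ A : ℝ, 0 < A ∧ ∀ t : ℝ, 0 < t → ∀ φ : 𝓢(EuclideanSpace ℝ (Fin n), ℂ),
      (∀ x, Integrable (mlIntegrand 0 α β lam σ t φ x)) ∧
      (∀ x, Integrable (mlIntegrand σ α α lam σ t φ x)) ∧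
      MemLp (mlOperator 0 α β lam σ t φ) q volume ∧
      MemHomSobolev σ q (mlOperator 0 α α lam σ t φ) ∧
      eLpNorm (mlOperator 0 α β lam σ t φ) q volume ≤
        ENNReal.ofReal (A * t ^ (-(α / σ) * (dimDiv n p - dimDiv n q - γ))) *
          eLpNorm (fracLaplacian γ φ) p volume ∧
      eLpNorm (mlOperator σ α α lam σ t φ) q volume ≤
        ENNReal.ofReal (A * t ^ (-α - (α / σ) * (dimDiv n p - dimDiv n q - γ))) *
          eLpNorm (fracLaplacian γ φ) p volume := by
  obtain ⟨C₁, hC₁, h₁⟩ := exists_multiplierBound_mlSymbol β hα0 hα1 hlam n σ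
  -- This bound only makes the symbol of `E_{α,α}` itself integrable, as Sobolev membership
  -- requires; `C₀` does not enter the constant `A`.
  obtain ⟨C₀, hC₀, h₀⟩ := exists_multiplierBound_mlSymbol α hα0 hα1 hlam n σ
  obtain ⟨C₂, hC₂, h₂⟩ := exists_multiplierBound_mlSymbol_self hα0 hα1 hlam n σ
  obtain ⟨A, hA, hest⟩ := exists_eLpNorm_fourierInv_le_of_multiplierBound hn hc α
  refine ⟨A * max C₁ C₂, by positivity, fun t ht φ => ?_⟩
  have hK₂ : 0 < C₂ * t ^ (-α) := by positivity
  have hm₁ := measurable_mlSymbol 0 hα0 β lam σ t φ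
  have hm₀ := measurable_mlSymbol 0 hα0 α lam σ t φ
  have hm₂ := measurable_mlSymbol σ hα0 α lam σ t φ
  have hi₂ := integrable_of_multiplierBound hK₂.le ht hm₂ (h₂ t ht φ)
  simp only [mlOperator_eq]
  refine ⟨integrable_mlIntegrand (integrable_of_multiplierBound hC₁.le ht hm₁ (h₁ t ht φ)),
    integrable_mlIntegrand hi₂,
    memLp_fourierInv_of_multiplierBound hn hc hC₁.le ht hm₁ (h₁ t ht φ), ?_, ?_, ?_⟩
  · refine memHomSobolev_fourierInv
      (integrable_of_multiplierBound hC₀.le ht hm₀ (h₀ t ht φ)) hi₂ (fun ξ => ?_)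
      (memLp_fourierInv_of_multiplierBound hn hc hK₂.le ht hm₂ (h₂ t ht φ))
    simp only [mlSymbol, Real.rpow_zero, Complex.ofReal_one, one_mul, mul_assoc]
  · refine (hest t C₁ ht hC₁ φ _ hm₁ (h₁ t ht φ)).trans ?_
    gcongr
    exact le_max_left _ _
  · refine (hest t _ ht hK₂ φ _ hm₂ (h₂ t ht φ)).trans ?_
    gcongr ENNReal.ofReal ?_ * _
    calc A * (C₂ * t ^ (-α)) * t ^ (-(α / σ) * (dimDiv n p - dimDiv n q - γ))
        = A * C₂ * t ^ (-α - (α / σ) * (dimDiv n p - dimDiv n q - γ)) := by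
          rw [sub_eq_add_neg (-α), Real.rpow_add ht, neg_mul]
          ring
      _ ≤ _ := by
          gcongr
          exact le_max_right _ _

end Estimates

theorem mainTheorem3 (n : ℕ) (hn : 0 < n) (α β : ℝ) (hα0 : 0 < α) (hα1 : α ≤ 1) (hβ : 0 < β)
    (lam : ℂ) (hlam : AdmissibleLambda α lam) :
    (∀ (σ : ℝ) (p q : ℝ≥0∞), LebesgueCase n σ p q →
      ∃ A : ℝ, 0 < A ∧ ∀ t : ℝ, 0 < t → ∀ φ : 𝓢(EuclideanSpace ℝ (Fin n), ℂ),
        (∀ x, Integrable (mlIntegrand 0 α β lam σ t φ x)) ∧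
        (∀ x, Integrable (mlIntegrand σ α α lam σ t φ x)) ∧
        MemLp (mlOperator 0 α β lam σ t φ) q volume ∧
        MemHomSobolev σ q (mlOperator 0 α α lam σ t φ) ∧
        eLpNorm (mlOperator 0 α β lam σ t φ) q volume ≤
          ENNReal.ofReal (A * t ^ (-(α / σ) * (dimDiv n p - dimDiv n q))) *
            eLpNorm φ p volume ∧
        eLpNorm (mlOperator σ α α lam σ t φ) q volume ≤
          ENNReal.ofReal (A * t ^ (-α - (α / σ) * (dimDiv n p - dimDiv n q))) *
            eLpNorm φ p volume) ∧
    (∀ (σ γ : ℝ) (p q : ℝ≥0∞), SobolevCase n σ γ p q →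
      ∃ A : ℝ, 0 < A ∧ ∀ t : ℝ, 0 < t → ∀ φ : 𝓢(EuclideanSpace ℝ (Fin n), ℂ),
        (∀ x, Integrable (mlIntegrand 0 α β lam σ t φ x)) ∧
        (∀ x, Integrable (mlIntegrand σ α α lam σ t φ x)) ∧
        MemLp (mlOperator 0 α β lam σ t φ) q volume ∧
        MemHomSobolev σ q (mlOperator 0 α α lam σ t φ) ∧
        eLpNorm (mlOperator 0 α β lam σ t φ) q volume ≤
          ENNReal.ofReal (A * t ^ (-(α / σ) * (dimDiv n p - dimDiv n q - γ))) *
            eLpNorm (fracLaplacian γ φ) p volume ∧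
        eLpNorm (mlOperator σ α α lam σ t φ) q volume ≤
          ENNReal.ofReal (A * t ^ (-α - (α / σ) * (dimDiv n p - dimDiv n q - γ))) *
            eLpNorm (fracLaplacian γ φ) p volume) := by
  refine ⟨fun σ p q h => ?_, fun σ γ p q h => ?_⟩
  -- The Lebesgue estimates are the case `γ = 0`, where `fracLaplacian 0 φ = φ` by Fourier
  -- inversion.
  · have := mlOperator_estimates hn β hα0 hα1 hlam (h.estimateCase hn)
    simpa only [fracLaplacian_zero, sub_zero] using this
  · exact mlOperator_estimates hn β hα0 hα1 hlam (h.estimateCase hn).2
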